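/- Fix $\zeta\in\mathbb T$. Let $V$ be a finite-dimensional complex vector space with a representation $\pi$ of $\mathbb T$, let $e_1,\dots,e_n$ be a basis of $V$ with $\pi_z(e_i)=z^{d_i}e_i$, $d_i\in\mathbb Z$, and let $\omega=\sum_{i,j}\omega_{ij}\,e_i\otimes e_j\in V\otimes V$ be homogeneous of degree $d\in\mathbb Z$, that is, $(\pi_z\otimes\pi_z)\omega=z^d\omega$ for all $z\in\mathbb T$. Assume that $\Omega=(\omega_{ij})$ satisfies $\overline{\Omega}\,\Omega=c\cdot\pi_{\zeta^d}$ for some $c\in\mathbb C\setminus\{0\}$, where $\pi_{\zeta^d}$ is written as a matrix in the basis $(e_i)$. Let $A_o=A_o(V,\pi,\omega)$ be the universal unital C*-algebra with generators $u_{ij}$, $1\le i,j\le n$, and the relations $$\sum_k u_{ki}^*u_{kj}=\delta_{ij},\qquad \sum_k u_{ik}u_{jk}^*=\delta_{ij},\qquad \zeta^{d_jd_i}\sum_k\omega_{ik}u_{jk}=\zeta^{d_j(d-d_j)}\sum_k\omega_{kj}u_{ki}^*$$ for all $1\le i,j\le n$, i.e. the completion of the universal unital *-algebra with these generators and relations in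 its largest C*-seminorm. A continuous $\mathbb T$-action on a unital C*-algebra $B$ is a unital *-homomorphism $\beta\colon B\to C(\mathbb T,B)$, $b\mapsto(z\mapsto\beta_z(b))$, with $\beta_1=\mathrm{id}$ and $\beta_{zw}=\beta_z\beta_w$. For $\mathbb T$-C*-algebras $B$ and $C$ the braided tensor product $B\boxtimes_\zeta C$ is the C*-algebra generated by the operators $j_1(x)=x\otimes 1$ and $j_2(y)=\Psi(y\otimes 1)\Psi^*$ on $\mathcal H\otimes\mathcal K$, for $x\in B\subseteq\mathbb B(\mathcal H)$, $y\in C\subseteq\mathbb B(\mathcal K)$. Here $\mathcal H$ and $\mathcal K$ carry faithful $\mathbb T$-covariant representations of $B$ and $C$, and $\Psi\colon\mathcal K\otimes\mathcal H\to\mathcal H\otimes\mathcal K$ is the unitary $\Psi(\eta\otimes\xi)=\zeta^{kl}\,\xi\otimes\eta$ for $\xi\in\mathcal H$, $\eta\in\mathcal K$ homogeneous of degrees $k$, $l$. It carries the diagonal action $\beta_z\boxtimes\gamma_z$; $\boxtimes_\zeta$ is functorial for equivariant unital *-homomorphisms and associative, with canonical identifications $(B\boxtimes_\zeta C)\boxtimes_\zeta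 D\cong B\boxtimes_\zeta C\boxtimes_\zeta D\cong B\boxtimes_\zeta(C\boxtimes_\zeta D)$. Then: 1. There is a unique unital *-homomorphism $\beta\colon A_o\to C(\mathbb T,A_o)$ with $\beta_z(u_{ij})=z^{d_j-d_i}u_{ij}$ for all $i,j$ and $z$, and $\beta$ is a continuous $\mathbb T$-action on $A_o$. 2. For this action there is a unique unital *-homomorphism $\Delta\colon A_o\to A_o\boxtimes_\zeta A_o$ with $\Delta(u_{ik})=\sum_{l=1}^n j_1(u_{il})\,j_2(u_{lk})$ for all $i,k$. 3. $\Delta$ is $\mathbb T$-equivariant; it is coassociative, $(\Delta\boxtimes\mathrm{id})\circ\Delta=(\mathrm{id}\boxtimes\Delta)\circ\Delta$ as maps to $A_o\boxtimes_\zeta A_o\boxtimes_\zeta A_o$; and it satisfies the two Podleś conditions: the closed linear spans of $\Delta(A_o)\,j_2(A_o)$ and of $j_1(A_o)\,\Delta(A_o)$ are both equal to $A_o\boxtimes_\zeta A_o$. That is, $(A_o,\beta,\Delta)$ is a braided compact quantum group over $\mathbb T$. -/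

import Mathlib

open scoped TensorProduct ENNReal lp

noncomputable section

/-! ### C*-seminorms and their completions -/

/-- A C*-seminorm on a complex unital *-algebra. -/
structure CStarSeminorm (A : Type*) [Ring A] [StarRing A] [Algebra ℂ A] extends Seminorm ℂ A where
  mul_le' : ∀ a b, toFun (a * b) ≤ toFun a * toFun b
  star_mul_self' : ∀ a, toFun (star a * a) = toFun a * toFun a

namespace CStarSeminorm

section

variable {A : Type*} [Ring A] [StarRing A] [Algebra ℂ A]

theorem le_star (p : CStarSeminorm A) (a : A) : p.toSeminorm a ≤ p.toSeminorm (star a) := by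
  have h1 : p.toSeminorm a * p.toSeminorm a ≤ p.toSeminorm (star a) * p.toSeminorm a :=
    (p.star_mul_self' a).symm.le.trans (p.mul_le' _ _)
  rcases (apply_nonneg p.toSeminorm a).eq_or_lt with h | h
  · rw [← h]; exact apply_nonneg _ _
  · exact le_of_mul_le_mul_right h1 h

theorem map_star (p : CStarSeminorm A) (a : A) : p.toSeminorm (star a) = p.toSeminorm a :=
  le_antisymm (by simpa using p.le_star (star a)) (p.le_star a)

/-- The algebra `A`, seminormed by `p`. -/
def Carrier (_ : CStarSeminorm A) : Type _ := A

variable (p : CStarSeminorm A)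

instance : Ring p.Carrier := inferInstanceAs (Ring A)
instance : StarRing p.Carrier := inferInstanceAs (StarRing A)
instance : Algebra ℂ p.Carrier := inferInstanceAs (Algebra ℂ A)

instance : SeminormedRing p.Carrier :=
  RingSeminorm.toSeminormedRing (R := p.Carrier)
    { toFun := p.toFun
      map_zero' := map_zero p.toSeminorm
      add_le' := map_add_le_add p.toSeminorm
      neg' := map_neg_eq_map p.toSeminorm
      mul_le' := p.mul_le' }

instance : NormedAlgebra ℂ p.Carrier where
  norm_smul_le r x := (map_smul_eq_mul p.toSeminorm r x).le

instance : NormedStarGroup p.Carrier where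
  norm_star_le a := (p.map_star a).le

/-- The Hausdorff completion of `A` for the C*-seminorm `p`. -/
abbrev Completion : Type _ := UniformSpace.Completion p.Carrier

instance : NormedAlgebra ℂ p.Completion where
  norm_smul_le := norm_smul_le

/-- The canonical map to the completion. -/
def toCompl (a : A) : p.Completion := UniformSpace.Completion.coe' (α := p.Carrier) a

theorem norm_toCompl (a : A) : ‖p.toCompl a‖ = p.toSeminorm a :=
  UniformSpace.Completion.norm_coe (E := p.Carrier) a

theorem dense_toCompl : DenseRange p.toCompl :=
  UniformSpace.Completion.denseRange_coe (α := p.Carrier)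

theorem toCompl_add (a b : A) : p.toCompl (a + b) = p.toCompl a + p.toCompl b :=
  UniformSpace.Completion.coe_add (α := p.Carrier) a b
theorem toCompl_mul (a b : A) : p.toCompl (a * b) = p.toCompl a * p.toCompl b :=
  UniformSpace.Completion.coe_mul (α := p.Carrier) a b
theorem toCompl_smul (c : ℂ) (a : A) : p.toCompl (c • a) = c • p.toCompl a :=
  UniformSpace.Completion.coe_smul (X := p.Carrier) c a
theorem toCompl_algebraMap (c : ℂ) :
    p.toCompl (algebraMap ℂ A c) = algebraMap ℂ p.Completion c := rfl

theorem eq_of_dense {T : Type*} [TopologicalSpace T] [T2Space T] (f g : p.Completion → T)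
    (hf : Continuous f) (hg : Continuous g) (h : ∀ a, f (p.toCompl a) = g (p.toCompl a)) (x) :
    f x = g x :=
  congrFun (p.dense_toCompl.equalizer hf hg (funext h)) x

instance : Star p.Completion where
  star := UniformSpace.Completion.map (star : p.Carrier → p.Carrier)

theorem star_toCompl (a : A) : star (p.toCompl a) = p.toCompl (star a) :=
  UniformSpace.Completion.map_coe (α := p.Carrier) (β := p.Carrier)
    (starNormedAddGroupHom (E := p.Carrier)).uniformContinuous a

theorem continuous_star' : Continuous (star : p.Completion → p.Completion) :=
  UniformSpace.Completion.continuous_map (α := p.Carrier) (β := p.Carrier)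

instance : ContinuousStar p.Completion := ⟨p.continuous_star'⟩

instance : StarRing p.Completion where
  star_involutive := p.eq_of_dense (fun x => star (star x)) (fun x => x) (by fun_prop) (by fun_prop)
    fun a => by simp only [star_toCompl, star_star]
  star_mul x y := by
    refine p.eq_of_dense (fun y => star (x * y)) (fun y => star y * star x) (by fun_prop)
      (by fun_prop) (fun b => ?_) y
    refine p.eq_of_dense (fun x => star (x * p.toCompl b)) (fun x => star (p.toCompl b) * star x)
      (by fun_prop) (by fun_prop) (fun a => ?_) x
    simp only [← toCompl_mul, star_toCompl, star_mul]
  star_add x y := by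
    refine p.eq_of_dense (fun y => star (x + y)) (fun y => star x + star y) (by fun_prop)
      (by fun_prop) (fun b => ?_) y
    refine p.eq_of_dense (fun x => star (x + p.toCompl b)) (fun x => star x + star (p.toCompl b))
      (by fun_prop) (by fun_prop) (fun a => ?_) x
    simp only [← toCompl_add, star_toCompl, star_add]

theorem norm_star_mul_self' (x : p.Completion) : ‖star x * x‖ = ‖x‖ * ‖x‖ := by
  refine p.eq_of_dense (fun x => ‖star x * x‖) (fun x => ‖x‖ * ‖x‖) (by fun_prop) (by fun_prop)
    (fun a => ?_) x
  simp only [star_toCompl, ← toCompl_mul, norm_toCompl]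
  exact p.star_mul_self' a

/-- The canonical *-homomorphism to the completion. -/
def incl : A →⋆ₐ[ℂ] p.Completion where
  toFun := p.toCompl
  map_one' := rfl
  map_mul' := p.toCompl_mul
  map_zero' := rfl
  map_add' := p.toCompl_add
  commutes' _ := rfl
  map_star' a := (p.star_toCompl a).symm

theorem norm_incl (a : A) : ‖p.incl a‖ = p.toSeminorm a := p.norm_toCompl a
theorem dense_incl : DenseRange p.incl := p.dense_toCompl

theorem continuous_of_le {D : Type*} [CStarAlgebra D] (φ : A →⋆ₐ[ℂ] D)
    (h : ∀ a, ‖φ a‖ ≤ p.toSeminorm a) : Continuous (X := p.Carrier) φ :=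
  AddMonoidHomClass.continuous_of_bound (E := p.Carrier)
    (RingHomClass.toRingHom φ : p.Carrier →+* D) 1 fun a => by rw [one_mul]; exact h a

end

variable {A : Type*} [Ring A] [StarRing A] [Algebra ℂ A] [StarModule ℂ A] (p : CStarSeminorm A)

theorem star_smul' (r : ℂ) (x : p.Completion) : star (r • x) = star r • star x := by
  have h1 : Continuous fun x : p.Completion => star (r • x) :=
    continuous_star.comp (continuous_const_smul r)
  have h2 : Continuous fun x : p.Completion => star r • star x :=
    continuous_star.const_smul (star r)
  refine p.eq_of_dense _ _ h1 h2 (fun a => ?_) x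
  simp only [← toCompl_smul, star_toCompl, star_smul]

instance : CStarAlgebra p.Completion where
  norm_mul_self_le x := (p.norm_star_mul_self' x).symm.le
  star_smul := p.star_smul'

/-- A *-homomorphism that is bounded by `p` extends to the completion. -/
def lift {D : Type*} [CStarAlgebra D] (φ : A →⋆ₐ[ℂ] D) (h : ∀ a, ‖φ a‖ ≤ p.toSeminorm a) :
    p.Completion →⋆ₐ[ℂ] D :=
  let ψ : p.Completion →+* D := UniformSpace.Completion.extensionHom
    (RingHomClass.toRingHom φ : p.Carrier →+* D) (p.continuous_of_le φ h)
  have hc : Continuous ψ := UniformSpace.Completion.continuous_extension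
  have he (a : A) : ψ (p.incl a) = φ a :=
    UniformSpace.Completion.extensionHom_coe _ (p.continuous_of_le φ h) a
  { ψ with
    commutes' := fun r => (he (algebraMap ℂ A r)).trans (AlgHomClass.commutes φ r)
    map_star' := p.eq_of_dense (fun x => ψ (star x)) (fun x => star (ψ x)) (by fun_prop)
      (by fun_prop) fun a => by
        change ψ (star (p.incl a)) = star (ψ (p.incl a))
        rw [← StarHomClass.map_star, he, he, StarHomClass.map_star] }

theorem lift_incl {D : Type*} [CStarAlgebra D] (φ : A →⋆ₐ[ℂ] D)
    (h : ∀ a, ‖φ a‖ ≤ p.toSeminorm a) (a : A) : p.lift φ h (p.incl a) = φ a :=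
  UniformSpace.Completion.extensionHom_coe _ (p.continuous_of_le φ h) a

/-- The C*-seminorm `a ↦ sup_i ‖φ_i a‖` of a pointwise bounded family of *-homomorphisms to
C*-algebras. -/
def ofFamily {A : Type*} [Ring A] [StarRing A] [Algebra ℂ A] {I : Type*} {D : I → Type*}
    [∀ i, CStarAlgebra (D i)] (φ : ∀ i, A →⋆ₐ[ℂ] D i)
    (hb : ∀ a, BddAbove (Set.range fun i => ‖φ i a‖)) : CStarSeminorm A where
  toFun a := ⨆ i, ‖φ i a‖
  map_zero' := by simp
  add_le' a b := Real.iSup_le (fun i => by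
      rw [map_add]
      exact (norm_add_le _ _).trans (add_le_add (le_ciSup (hb a) i) (le_ciSup (hb b) i)))
    (add_nonneg (Real.iSup_nonneg fun _ => norm_nonneg _) (Real.iSup_nonneg fun _ => norm_nonneg _))
  neg' a := by simp
  smul' r a := by
    simp only [map_smul, norm_smul]
    exact (Real.mul_iSup_of_nonneg (norm_nonneg r) _).symm
  mul_le' a b := Real.iSup_le (fun i => by
      rw [map_mul]
      exact (norm_mul_le _ _).trans (mul_le_mul (le_ciSup (hb a) i) (le_ciSup (hb b) i)
        (norm_nonneg _) (Real.iSup_nonneg fun _ => norm_nonneg _)))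
    (mul_nonneg (Real.iSup_nonneg fun _ => norm_nonneg _) (Real.iSup_nonneg fun _ => norm_nonneg _))
  star_mul_self' a := by
    have h0 : 0 ≤ ⨆ i, ‖φ i a‖ := Real.iSup_nonneg fun _ => norm_nonneg _
    have he : ∀ i, ‖φ i (star a * a)‖ = ‖φ i a‖ * ‖φ i a‖ := fun i => by
      rw [map_mul, StarHomClass.map_star, CStarRing.norm_star_mul_self]
    refine le_antisymm (Real.iSup_le (fun i => ?_) (mul_nonneg h0 h0)) ?_
    · rw [he]
      exact mul_self_le_mul_self (norm_nonneg _) (le_ciSup (hb a) i)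
    · have h1 : (⨆ i, ‖φ i a‖) ≤ √(⨆ i, ‖φ i (star a * a)‖) := by
        refine Real.iSup_le (fun i => Real.le_sqrt_of_sq_le ?_) (Real.sqrt_nonneg _)
        rw [sq, ← he]
        exact le_ciSup (hb (star a * a)) i
      calc _ ≤ √(⨆ i, ‖φ i (star a * a)‖) * √(⨆ i, ‖φ i (star a * a)‖) :=
            mul_self_le_mul_self h0 h1
        _ = _ := Real.mul_self_sqrt (Real.iSup_nonneg fun _ => norm_nonneg _)

section Family

variable {I : Type*} {D : I → Type*} [∀ i, CStarAlgebra (D i)] (φ : ∀ i, A →⋆ₐ[ℂ] D i)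
  (hb : ∀ a, BddAbove (Set.range fun i => ‖φ i a‖))

/-- The members of the family extend to the completion for the supremum seminorm. -/
def evalFamily (i : I) : (ofFamily φ hb).Completion →⋆ₐ[ℂ] D i :=
  (ofFamily φ hb).lift (φ i) fun a => le_ciSup (hb a) i

theorem evalFamily_incl (i : I) (a : A) :
    evalFamily φ hb i ((ofFamily φ hb).incl a) = φ i a :=
  lift_incl _ _ _ a

theorem norm_le_of_evalFamily (x : (ofFamily φ hb).Completion) {C : ℝ} (hC : 0 ≤ C)
    (h : ∀ i, ‖evalFamily φ hb i x‖ ≤ C) : ‖x‖ ≤ C := by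
  refine le_of_forall_pos_le_add fun ε hε => ?_
  obtain ⟨a, ha⟩ := Metric.denseRange_iff.mp (ofFamily φ hb).dense_incl x (ε / 2) (by positivity)
  rw [dist_eq_norm] at ha
  have h1 : ‖(ofFamily φ hb).incl a‖ ≤ C + ε / 2 := by
    rw [norm_incl]
    refine Real.iSup_le (fun i => ?_) (by positivity)
    rw [← evalFamily_incl φ hb]
    have h2 := norm_sub_norm_le (evalFamily φ hb i ((ofFamily φ hb).incl a)) (evalFamily φ hb i x)
    rw [← map_sub] at h2
    have h3 := NonUnitalStarAlgHom.norm_apply_le (evalFamily φ hb i)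
      ((ofFamily φ hb).incl a - x)
    rw [norm_sub_rev] at ha
    linarith [h i]
  have := norm_le_norm_add_norm_sub' x ((ofFamily φ hb).incl a)
  linarith

theorem ext_evalFamily {x y : (ofFamily φ hb).Completion}
    (h : ∀ i, evalFamily φ hb i x = evalFamily φ hb i y) : x = y := by
  rw [← sub_eq_zero, ← norm_le_zero_iff]
  exact norm_le_of_evalFamily φ hb _ le_rfl fun i => by simp [h i]

end Family

end CStarSeminorm

/-! ### Free *-algebras -/

/-- `Aᵐᵒᵖ` with the conjugate complex structure. -/
def ConjOp (A : Type*) : Type _ := Aᵐᵒᵖ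

namespace ConjOp

variable {A : Type*} [Ring A] [Algebra ℂ A]

instance : Ring (ConjOp A) := inferInstanceAs (Ring Aᵐᵒᵖ)

instance : Algebra ℂ (ConjOp A) :=
  ((algebraMap ℂ Aᵐᵒᵖ).comp (starRingEnd ℂ)).toAlgebra' fun c x =>
    Algebra.commutes (A := Aᵐᵒᵖ) (starRingEnd ℂ c) x

end ConjOp

/-- The free unital complex *-algebra on a set `X`: the free algebra on the letters `x` and `x*`. -/
def FreeStarAlgebra (X : Type*) : Type _ := FreeAlgebra ℂ (X ⊕ X)

namespace FreeStarAlgebra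

variable {X : Type*}

instance : Ring (FreeStarAlgebra X) := inferInstanceAs (Ring (FreeAlgebra ℂ (X ⊕ X)))
instance : Algebra ℂ (FreeStarAlgebra X) := inferInstanceAs (Algebra ℂ (FreeAlgebra ℂ (X ⊕ X)))

/-- The letters: `letter (inl x)` is `x` and `letter (inr x)` is `x*`. -/
def letter (y : X ⊕ X) : FreeStarAlgebra X := FreeAlgebra.ι ℂ y

/-- The generators. -/
def of (x : X) : FreeStarAlgebra X := letter (Sum.inl x)

/-- The involution, as a homomorphism to the conjugate opposite algebra. -/
def starAux : FreeAlgebra ℂ (X ⊕ X) →ₐ[ℂ] ConjOp (FreeAlgebra ℂ (X ⊕ X)) :=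
  FreeAlgebra.lift ℂ fun y => MulOpposite.op (FreeAlgebra.ι ℂ y.swap)

instance : Star (FreeStarAlgebra X) where
  star a := MulOpposite.unop (starAux a : (FreeAlgebra ℂ (X ⊕ X))ᵐᵒᵖ)

theorem star_letter (y : X ⊕ X) : star (letter y) = letter y.swap := by
  have h : starAux (FreeAlgebra.ι ℂ y) = MulOpposite.op (FreeAlgebra.ι ℂ y.swap) :=
    FreeAlgebra.lift_ι_apply _ y
  exact congrArg MulOpposite.unop h

theorem star_algebraMap' (c : ℂ) :
    star (algebraMap ℂ (FreeStarAlgebra X) c) = algebraMap ℂ (FreeStarAlgebra X) (star c) :=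
  congrArg MulOpposite.unop (starAux.commutes c)

theorem star_mul' (a b : FreeStarAlgebra X) : star (a * b) = star b * star a :=
  congrArg MulOpposite.unop (starAux.map_mul a b)

theorem star_add' (a b : FreeStarAlgebra X) : star (a + b) = star a + star b :=
  congrArg MulOpposite.unop (starAux.map_add a b)

theorem induction_letter {P : FreeStarAlgebra X → Prop} (h0 : ∀ c, P (algebraMap ℂ _ c))
    (h1 : ∀ y, P (letter y)) (h2 : ∀ a b, P a → P b → P (a * b))
    (h3 : ∀ a b, P a → P b → P (a + b)) (a : FreeStarAlgebra X) : P a :=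
  FreeAlgebra.induction ℂ (X ⊕ X) h0 h1 h2 h3 a

instance : StarRing (FreeStarAlgebra X) where
  star_involutive a := by
    induction a using induction_letter with
    | h0 c => rw [star_algebraMap', star_algebraMap', star_star]
    | h1 y => rw [star_letter, star_letter, Sum.swap_swap]
    | h2 a b ha hb => rw [star_mul', star_mul', ha, hb]
    | h3 a b ha hb => rw [star_add', star_add', ha, hb]
  star_mul := star_mul'
  star_add := star_add'

instance : StarModule ℂ (FreeStarAlgebra X) where
  star_smul c a := by
    rw [Algebra.smul_def, Algebra.smul_def, star_mul', star_algebraMap', Algebra.commutes]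

section

variable {D : Type*} [Ring D] [StarRing D] [Algebra ℂ D] [StarModule ℂ D]

/-- The *-homomorphism with prescribed values on the generators. -/
def lift (f : X → D) : FreeStarAlgebra X →⋆ₐ[ℂ] D where
  __ := (FreeAlgebra.lift ℂ (Sum.elim f fun x => star (f x)) : FreeAlgebra ℂ (X ⊕ X) →ₐ[ℂ] D)
  map_star' a := by
    let g : FreeStarAlgebra X →ₐ[ℂ] D :=
      (FreeAlgebra.lift ℂ (Sum.elim f fun x => star (f x)) : FreeAlgebra ℂ (X ⊕ X) →ₐ[ℂ] D)
    have hg (y) : g (letter y) =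
      Sum.elim f (fun x => star (f x)) y := FreeAlgebra.lift_ι_apply _ _
    change g (star a) = star (g a)
    induction a using induction_letter with
    | h0 c => rw [star_algebraMap', AlgHom.commutes, AlgHom.commutes, algebraMap_star_comm]
    | h1 y => rw [star_letter, hg, hg]; cases y <;> simp
    | h2 a b ha hb => rw [star_mul', map_mul, map_mul, star_mul, ha, hb]
    | h3 a b ha hb => rw [star_add', map_add, map_add, star_add, ha, hb]

theorem lift_of (f : X → D) (x : X) : lift f (of x) = f x :=
  FreeAlgebra.lift_ι_apply _ _

theorem star_of (x : X) : star (of x) = letter (Sum.inr x) :=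
  star_letter _

theorem induction {P : FreeStarAlgebra X → Prop} (h0 : ∀ c, P (algebraMap ℂ _ c))
    (h1 : ∀ x, P (of x)) (h1' : ∀ x, P (star (of x))) (h2 : ∀ a b, P a → P b → P (a * b))
    (h3 : ∀ a b, P a → P b → P (a + b)) (a : FreeStarAlgebra X) : P a :=
  induction_letter h0 (fun y => y.casesOn h1 fun x => star_of x ▸ h1' x) h2 h3 a

theorem hom_ext {φ ψ : FreeStarAlgebra X →⋆ₐ[ℂ] D} (h : ∀ x, φ (of x) = ψ (of x)) : φ = ψ := by
  ext a
  induction a using induction with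
  | h0 c => rw [AlgHomClass.commutes, AlgHomClass.commutes]
  | h1 x => exact h x
  | h1' x => rw [map_star, map_star, h]
  | h2 a b ha hb => rw [map_mul, map_mul, ha, hb]
  | h3 a b ha hb => rw [map_add, map_add, ha, hb]

end

/-- A family of *-homomorphisms is pointwise bounded if it is bounded on the generators. -/
theorem bddAbove {I : Type*} {D : I → Type*} [∀ i, CStarAlgebra (D i)]
    (φ : ∀ i, FreeStarAlgebra X →⋆ₐ[ℂ] D i) (M : X → ℝ) (hM : ∀ i x, ‖φ i (of x)‖ ≤ M x)
    (a : FreeStarAlgebra X) : BddAbove (Set.range fun i => ‖φ i a‖) := by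
  suffices ∃ C, ∀ i, ‖φ i a‖ ≤ C from
    let ⟨C, hC⟩ := this; ⟨C, by rintro _ ⟨i, rfl⟩; exact hC i⟩
  induction a using induction with
  | h0 c =>
    refine ⟨‖c‖, fun i => ?_⟩
    rw [AlgHomClass.commutes, Algebra.algebraMap_eq_smul_one, norm_smul]
    rcases subsingleton_or_nontrivial (D i) with h | h
    · simp [Subsingleton.elim (1 : D i) 0]
    · simp
  | h1 x => exact ⟨M x, fun i => hM i x⟩
  | h1' x => exact ⟨M x, fun i => by rw [map_star, norm_star]; exact hM i x⟩
  | h2 a b ha hb =>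
    obtain ⟨C, hC⟩ := ha
    obtain ⟨C', hC'⟩ := hb
    exact ⟨C * C', fun i => by
      rw [map_mul]
      exact (norm_mul_le _ _).trans (mul_le_mul (hC i) (hC' i) (norm_nonneg _)
        ((norm_nonneg _).trans (hC i)))⟩
  | h3 a b ha hb =>
    obtain ⟨C, hC⟩ := ha
    obtain ⟨C', hC'⟩ := hb
    exact ⟨C + C', fun i => by
      rw [map_add]
      exact (norm_add_le _ _).trans (add_le_add (hC i) (hC' i))⟩

end FreeStarAlgebra

end

noncomputable section

/-! ### The C*-algebra `A_o(V, π, ω)` -/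

/-- The defining relations: `u` is a unitary matrix and `ω` is an invariant vector. -/
structure BraidedOrthogonalRelations {n : ℕ} (ζ : Circle) (d : ℤ) (deg : Fin n → ℤ)
    (Ω : Matrix (Fin n) (Fin n) ℂ) {A : Type*} [Ring A] [StarRing A] [Algebra ℂ A]
    (u : Fin n → Fin n → A) : Prop where
  isometry : ∀ i j, ∑ k, star (u k i) * u k j = if i = j then 1 else 0
  coisometry : ∀ i j, ∑ k, u i k * star (u j k) = if i = j then 1 else 0
  invariant : ∀ i j, (ζ : ℂ) ^ (deg j * deg i) • ∑ k, Ω i k • u j k =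
    (ζ : ℂ) ^ (deg j * (d - deg j)) • ∑ k, Ω k j • star (u k i)

theorem norm_le_one_of_isometry {n : ℕ} {D : Type*} [CStarAlgebra D] (u : Fin n → Fin n → D)
    (h : ∀ i j, ∑ k, star (u k i) * u k j = if i = j then 1 else 0) (i j : Fin n) :
    ‖u i j‖ ≤ 1 := by
  let _ : PartialOrder D := CStarAlgebra.spectralOrder D
  have : StarOrderedRing D := CStarAlgebra.spectralOrderedRing D
  have h1 : star (u i j) * u i j ≤ 1 := by
    have := h j j
    rw [if_pos rfl] at this
    rw [← this]
    exact Finset.single_le_sum (f := fun k => star (u k j) * u k j)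
      (fun k _ => star_mul_self_nonneg _) (Finset.mem_univ i)
  have h2 : ‖star (u i j) * u i j‖ ≤ ‖(1 : D)‖ :=
    CStarAlgebra.norm_le_norm_of_nonneg_of_le (star_mul_self_nonneg _) h1
  rw [CStarRing.norm_star_mul_self] at h2
  have h3 : ‖(1 : D)‖ ≤ 1 := by
    rcases subsingleton_or_nontrivial D with h | h
    · simp [Subsingleton.elim (1 : D) 0]
    · simp
  nlinarith [norm_nonneg (u i j)]

section Ao

variable {n : ℕ} (ζ : Circle) (d : ℤ) (deg : Fin n → ℤ) (Ω : Matrix (Fin n) (Fin n) ℂ)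

/-- The C*-seminorms on the free *-algebra on `u_ij` that factor through the *-algebra with the
generators `u_ij` and the defining relations. -/
abbrev AoSeminorm : Type :=
  {p : CStarSeminorm (FreeStarAlgebra (Fin n × Fin n)) //
    BraidedOrthogonalRelations ζ d deg Ω fun i j => p.incl (.of (i, j))}

/-- The largest such C*-seminorm. -/
def AoMaxSeminorm : CStarSeminorm (FreeStarAlgebra (Fin n × Fin n)) :=
  .ofFamily (fun p : AoSeminorm ζ d deg Ω => p.1.incl)
    (FreeStarAlgebra.bddAbove _ (fun _ => 1) fun p x => norm_le_one_of_isometry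
      (fun i j => p.1.incl (.of (i, j))) p.2.isometry x.1 x.2)

/-- The universal unital C*-algebra with generators `u_ij` and the defining relations. -/
def Ao : Type := (AoMaxSeminorm ζ d deg Ω).Completion

instance : CStarAlgebra (Ao ζ d deg Ω) :=
  inferInstanceAs (CStarAlgebra (AoMaxSeminorm ζ d deg Ω).Completion)

/-- The generators `u_ij`. -/
def Ao.u (i j : Fin n) : Ao ζ d deg Ω := (AoMaxSeminorm ζ d deg Ω).incl (.of (i, j))

end Ao

/-! ### Operators on graded Hilbert spaces -/

section Hilbert

variable {ι κ μ : Type*}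

theorem two_pos_toReal : 0 < (2 : ℝ≥0∞).toReal := by norm_num

/-- The unitary `(W f)(a) = φ(a) f(e⁻¹ a)`. -/
def phaseReindex (e : κ ≃ ι) (φ : ι → Circle) : ℓ²(κ, ℂ) ≃ₗᵢ[ℂ] ℓ²(ι, ℂ) where
  toFun f := ⟨fun a => (φ a : ℂ) * f (e.symm a), (memℓp_gen_iff two_pos_toReal).mpr <| by
    simpa only [norm_mul, Circle.norm_coe, one_mul, Function.comp_def] using
      e.symm.summable_iff.mpr ((memℓp_gen_iff two_pos_toReal).mp (lp.memℓp f))⟩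
  invFun f := ⟨fun b => (φ (e b) : ℂ)⁻¹ * f (e b), (memℓp_gen_iff two_pos_toReal).mpr <| by
    simpa only [norm_mul, norm_inv, Circle.norm_coe, inv_one, one_mul, Function.comp_def] using
      e.summable_iff.mpr ((memℓp_gen_iff two_pos_toReal).mp (lp.memℓp f))⟩
  map_add' f g := lp.ext <| funext fun a => mul_add _ _ _
  map_smul' c f := lp.ext <| funext fun a => mul_left_comm _ _ _
  left_inv f := lp.ext <| funext fun b => by
    change (φ (e b) : ℂ)⁻¹ * ((φ (e b) : ℂ) * f (e.symm (e b))) = f b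
    rw [Equiv.symm_apply_apply, inv_mul_cancel_left₀ (Circle.coe_ne_zero _)]
  right_inv f := lp.ext <| funext fun a => by
    change (φ a : ℂ) * ((φ (e (e.symm a)) : ℂ)⁻¹ * f (e (e.symm a))) = f a
    rw [Equiv.apply_symm_apply, mul_inv_cancel_left₀ (Circle.coe_ne_zero _)]
  norm_map' f := by
    rw [lp.norm_eq_tsum_rpow two_pos_toReal, lp.norm_eq_tsum_rpow two_pos_toReal]
    congr 1
    rw [← e.symm.tsum_eq]
    refine tsum_congr fun a => ?_
    change ‖(φ a : ℂ) * f (e.symm a)‖ ^ _ = _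
    rw [norm_mul, Circle.norm_coe, one_mul]

@[simp] theorem phaseReindex_apply (e : κ ≃ ι) (φ : ι → Circle) (f : ℓ²(κ, ℂ)) (a : ι) :
    phaseReindex e φ f a = (φ a : ℂ) * f (e.symm a) := rfl

/-- The action `ρ_z λ_a = z ^ l_a λ_a` of the circle on the Hilbert space with an orthonormal basis
`(λ_a)` of vectors of degree `l_a`. -/
def circleRep (l : ι → ℤ) (z : Circle) : ℓ²(ι, ℂ) ≃ₗᵢ[ℂ] ℓ²(ι, ℂ) :=
  phaseReindex (Equiv.refl ι) fun a => z ^ l a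

/-- The braiding unitary `λ_b ⊗ λ_a ↦ ζ ^ (l_a l_b) λ_a ⊗ λ_b`, where `ℓ²(ι) ⊗ ℓ²(κ)` is
`ℓ²(ι × κ)`. -/
def braiding (ζ : Circle) (l : ι → ℤ) (m : κ → ℤ) : ℓ²(κ × ι, ℂ) ≃ₗᵢ[ℂ] ℓ²(ι × κ, ℂ) :=
  phaseReindex (Equiv.prodComm κ ι) fun x => ζ ^ (l x.1 * m x.2)

theorem summable_swap (f : ℓ²(ι × κ, ℂ)) :
    Summable fun x : κ × ι => ‖f (x.2, x.1)‖ ^ (2 : ℝ≥0∞).toReal :=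
  (Equiv.prodComm κ ι).summable_iff.mpr ((memℓp_gen_iff two_pos_toReal).mp (lp.memℓp f))

/-- The slice `f(·, b)`. -/
def slice (f : ℓ²(ι × κ, ℂ)) (b : κ) : ℓ²(ι, ℂ) :=
  ⟨fun a => f (a, b), (memℓp_gen_iff two_pos_toReal).mpr ((summable_swap f).prod_factor b)⟩

theorem norm_slice (f : ℓ²(ι × κ, ℂ)) (b : κ) : ‖slice f b‖ ^ (2 : ℝ≥0∞).toReal =
    ∑' a, ‖f (a, b)‖ ^ (2 : ℝ≥0∞).toReal := lp.norm_rpow_eq_tsum two_pos_toReal _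

theorem memℓp_slice (f : ℓ²(ι × κ, ℂ)) : Memℓp (slice f) 2 :=
  (memℓp_gen_iff two_pos_toReal).mpr <| by
    simp only [norm_slice]
    exact (summable_swap f).prod

theorem memℓp_unslice (g : lp (fun _ : κ => ℓ²(ι, ℂ)) 2) :
    Memℓp (fun x : ι × κ => g x.2 x.1) 2 := (memℓp_gen_iff two_pos_toReal).mpr <| by
  rw [← (Equiv.prodComm κ ι).summable_iff]
  refine (summable_prod_of_nonneg fun x => Real.rpow_nonneg (norm_nonneg _) _).mpr ⟨fun b => ?_, ?_⟩
  · exact (memℓp_gen_iff two_pos_toReal).mp (lp.memℓp (g b))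
  · have := (memℓp_gen_iff two_pos_toReal).mp (lp.memℓp g)
    simp only [lp.norm_rpow_eq_tsum two_pos_toReal] at this
    exact this

theorem norm_slices (f : ℓ²(ι × κ, ℂ)) :
    ‖(⟨slice f, memℓp_slice f⟩ : lp (fun _ : κ => ℓ²(ι, ℂ)) 2)‖ = ‖f‖ := by
  rw [lp.norm_eq_tsum_rpow two_pos_toReal, lp.norm_eq_tsum_rpow two_pos_toReal]
  congr 1
  rw [← (Equiv.prodComm κ ι).tsum_eq]
  exact (tsum_congr fun b => norm_slice f b).trans (summable_swap f).tsum_prod.symm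

/-- The identification of `ℓ²(ι × κ)` with the Hilbert sum of copies of `ℓ²(ι)` over `κ`. -/
def sliceEquiv (ι κ : Type*) : ℓ²(ι × κ, ℂ) ≃ₗᵢ[ℂ] lp (fun _ : κ => ℓ²(ι, ℂ)) 2 where
  toFun f := ⟨slice f, memℓp_slice f⟩
  invFun g := ⟨fun x => g x.2 x.1, memℓp_unslice g⟩
  map_add' _ _ := rfl
  map_smul' _ _ := rfl
  left_inv _ := rfl
  right_inv _ := rfl
  norm_map' := norm_slices

theorem sliceEquiv_apply (f : ℓ²(ι × κ, ℂ)) (b : κ) (a : ι) : sliceEquiv ι κ f b a = f (a, b) := rfl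

/-- The representation `T ↦ T^{⊕κ}` of the bounded operators on a Hilbert sum of copies. -/
def diagonalRep (E κ : Type*) [NormedAddCommGroup E] [InnerProductSpace ℂ E] [CompleteSpace E] :
    (E →L[ℂ] E) →⋆ₐ[ℂ] (lp (fun _ : κ => E) 2 →L[ℂ] lp (fun _ : κ => E) 2) where
  toFun T := lp.mapCLM 2 (fun _ => T) (norm_nonneg T) fun _ => le_rfl
  map_one' := rfl
  map_mul' _ _ := rfl
  map_zero' := rfl
  map_add' _ _ := rfl
  commutes' _ := rfl
  map_star' T := by
    rw [ContinuousLinearMap.star_eq_adjoint, ContinuousLinearMap.star_eq_adjoint,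
      ContinuousLinearMap.eq_adjoint_iff]
    intro f g
    rw [lp.inner_eq_tsum, lp.inner_eq_tsum]
    exact tsum_congr fun b => ContinuousLinearMap.adjoint_inner_left T (g b) (f b)

/-- Conjugation by a unitary. -/
def conjRep {H K : Type*} [NormedAddCommGroup H] [InnerProductSpace ℂ H] [CompleteSpace H]
    [NormedAddCommGroup K] [InnerProductSpace ℂ K] [CompleteSpace K] (e : H ≃ₗᵢ[ℂ] K) :
    (H →L[ℂ] H) →⋆ₐ[ℂ] (K →L[ℂ] K) :=
  StarAlgHomClass.toStarAlgHom e.conjStarAlgEquiv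

/-- The C*-algebra of bounded operators on `ℓ²(ι)`. -/
def Op (ι : Type*) : Type _ := ℓ²(ι, ℂ) →L[ℂ] ℓ²(ι, ℂ)

instance : CStarAlgebra (Op ι) := inferInstanceAs (CStarAlgebra (ℓ²(ι, ℂ) →L[ℂ] ℓ²(ι, ℂ)))

instance : FunLike (Op ι) ℓ²(ι, ℂ) ℓ²(ι, ℂ) :=
  inferInstanceAs (FunLike (ℓ²(ι, ℂ) →L[ℂ] ℓ²(ι, ℂ)) ℓ²(ι, ℂ) ℓ²(ι, ℂ))

theorem Op.map_smul (T : Op ι) (c : ℂ) (f : ℓ²(ι, ℂ)) : T (c • f) = c • T f :=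
  ContinuousLinearMap.map_smul (M₁ := ℓ²(ι, ℂ)) T c f

/-- Conjugation by a unitary. -/
def Op.conj (e : ℓ²(ι, ℂ) ≃ₗᵢ[ℂ] ℓ²(κ, ℂ)) : Op ι →⋆ₐ[ℂ] Op κ := conjRep e

theorem Op.conj_apply (e : ℓ²(ι, ℂ) ≃ₗᵢ[ℂ] ℓ²(κ, ℂ)) (T : Op ι) (f : ℓ²(κ, ℂ)) :
    Op.conj e T f = e (T (e.symm f)) := rfl

/-- The amplification `T ↦ T ⊗ 1`. -/
def amplify (ι κ : Type*) : Op ι →⋆ₐ[ℂ] Op (ι × κ) :=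
  (conjRep (sliceEquiv ι κ).symm).comp (diagonalRep ℓ²(ι, ℂ) κ)

theorem amplify_apply (T : Op ι) (f : ℓ²(ι × κ, ℂ)) (a : ι) (b : κ) :
    amplify ι κ T f (a, b) = T (sliceEquiv ι κ f b) a := rfl

/-- The map `S ↦ Ψ (S ⊗ 1) Ψ*` from operators on `ℓ²(κ)` to operators on `ℓ²(ι) ⊗ ℓ²(κ)`, where
`Ψ` is the braiding unitary. -/
def braidedAmplify (ζ : Circle) (l : ι → ℤ) (m : κ → ℤ) :
    Op κ →⋆ₐ[ℂ] Op (ι × κ) :=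
  (Op.conj (braiding ζ l m)).comp (amplify κ ι)

theorem braidedAmplify_apply (ζ : Circle) (l : ι → ℤ) (m : κ → ℤ)
    (S : Op κ) (f : ℓ²(ι × κ, ℂ)) (a : ι) (b : κ) :
    braidedAmplify ζ l m S f (a, b) =
      ((ζ ^ (l a * m b) : Circle) : ℂ) * S (sliceEquiv κ ι ((braiding ζ l m).symm f) a) b := rfl

theorem slice_braiding_symm (ζ : Circle) (l : ι → ℤ) (m : κ → ℤ) (f : ℓ²(ι × κ, ℂ)) (a : ι) (b : κ) :
    sliceEquiv κ ι ((braiding ζ l m).symm f) a b =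
      ((ζ ^ (l a * m b) : Circle) : ℂ)⁻¹ * f (a, b) := rfl

theorem circleRep_apply (l : ι → ℤ) (z : Circle) (f : ℓ²(ι, ℂ)) (a : ι) :
    circleRep l z f a = ((z ^ l a : Circle) : ℂ) * f a := rfl

end Hilbert

end

noncomputable section

namespace CStarSeminorm

variable {A : Type*} [Ring A] [StarRing A] [Algebra ℂ A] [StarModule ℂ A]
  {I : Type*} {D : I → Type*} [∀ i, CStarAlgebra (D i)] (φ : ∀ i, A →⋆ₐ[ℂ] D i)
  (hb : ∀ a, BddAbove (Set.range fun i => ‖φ i a‖))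

/-- A map to the completion for a supremum seminorm is a *-homomorphism if it is one in each
member of the family. -/
def homOfFamily {X : Type*} [CStarAlgebra X] (f : X → (ofFamily φ hb).Completion)
    (h : ∀ i, X →⋆ₐ[ℂ] D i) (hf : ∀ i x, evalFamily φ hb i (f x) = h i x) :
    X →⋆ₐ[ℂ] (ofFamily φ hb).Completion where
  toFun := f
  map_one' := ext_evalFamily φ hb fun i => by rw [hf, map_one, map_one]
  map_mul' x y := ext_evalFamily φ hb fun i => by rw [map_mul, hf, hf, hf, map_mul]
  map_zero' := ext_evalFamily φ hb fun i => by rw [hf, map_zero, map_zero]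
  map_add' x y := ext_evalFamily φ hb fun i => by rw [map_add, hf, hf, hf, map_add]
  commutes' c := ext_evalFamily φ hb fun i => by
    rw [hf, AlgHomClass.commutes, AlgHomClass.commutes]
  map_star' x := ext_evalFamily φ hb fun i => by
    rw [StarHomClass.map_star, hf, hf, StarHomClass.map_star]

end CStarSeminorm

theorem continuous_starAlgHom {A B : Type*} [CStarAlgebra A] [CStarAlgebra B] (f : A →⋆ₐ[ℂ] B) :
    Continuous f :=
  AddMonoidHomClass.continuous_of_bound f 1 fun a => by
    rw [one_mul]
    exact NonUnitalStarAlgHom.norm_apply_le f a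

/-! ### Circle actions and covariant representations -/

/-- A continuous action of the circle group on a unital C*-algebra. -/
structure CircleAction (B : Type) [CStarAlgebra B] where
  hom : B →⋆ₐ[ℂ] C(Circle, B)
  hom_one : ∀ b, hom b 1 = b
  hom_mul : ∀ z w b, hom b (z * w) = hom (hom b w) z

/-- The automorphism `β_z`. -/
def CircleAction.act {B : Type} [CStarAlgebra B] (β : CircleAction B) (z : Circle) : B →⋆ₐ[ℂ] B :=
  { toFun := fun b => β.hom b z
    map_one' := by rw [map_one]; rfl
    map_mul' := fun a b => by rw [map_mul]; rfl
    map_zero' := by rw [map_zero]; rfl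
    map_add' := fun a b => by rw [map_add]; rfl
    commutes' := fun c => by rw [AlgHomClass.commutes]; rfl
    map_star' := fun b => by rw [StarHomClass.map_star]; rfl }

theorem CircleAction.act_apply {B : Type} [CStarAlgebra B] (β : CircleAction B) (z : Circle)
    (b : B) : β.act z b = β.hom b z := rfl

/-- Equivariance of a *-homomorphism. -/
def IsEquivariant {X Y : Type} [CStarAlgebra X] [CStarAlgebra Y] (β : CircleAction X)
    (γ : CircleAction Y) (f : X →⋆ₐ[ℂ] Y) : Prop :=
  ∀ z x, f (β.act z x) = γ.act z (f x)

theorem CircleAction.isEquivariant_act {B : Type} [CStarAlgebra B] (β : CircleAction B)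
    (z : Circle) : IsEquivariant β β (β.act z) := fun w b => by
  simp only [act_apply, ← β.hom_mul, mul_comm]

theorem IsEquivariant.id {B : Type} [CStarAlgebra B] (β : CircleAction B) :
    IsEquivariant β β (StarAlgHom.id ℂ B) := fun _ _ => rfl

/-- A covariant representation on the Hilbert space with an orthonormal basis indexed by `idx`,
whose basis vectors are homogeneous of degree `deg`. -/
structure CovariantRep {B : Type} [CStarAlgebra B] (β : CircleAction B) where
  idx : Type
  deg : idx → ℤ
  rep : B →⋆ₐ[ℂ] Op idx
  covariant : ∀ z b ξ, circleRep deg z (rep b ξ) = rep (β.act z b) (circleRep deg z ξ)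

/-- The pull back of a covariant representation along an equivariant *-homomorphism. -/
def CovariantRep.pullback {X Y : Type} [CStarAlgebra X] [CStarAlgebra Y] {β : CircleAction X}
    {γ : CircleAction Y} (s : CovariantRep γ) (f : X →⋆ₐ[ℂ] Y) (hf : IsEquivariant β γ f) :
    CovariantRep β where
  idx := s.idx
  deg := s.deg
  rep := s.rep.comp f
  covariant z b ξ := by
    rw [StarAlgHom.comp_apply, StarAlgHom.comp_apply, hf, s.covariant]

/-! ### The braided tensor product -/

section Tensor

variable {X Y X' Y' : Type} [CStarAlgebra X] [CStarAlgebra Y] [CStarAlgebra X'] [CStarAlgebra Y']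
  (ζ : Circle) (β : CircleAction X) (γ : CircleAction Y)
  {β' : CircleAction X'} {γ' : CircleAction Y'}

variable {β γ} in
/-- The representation of the free *-algebra on `X ⊔ Y` on `ℓ²(r) ⊗ ℓ²(s)` by
`x ↦ x ⊗ 1` and `y ↦ Ψ (y ⊗ 1) Ψ*`. -/
def pairRep (r : CovariantRep β) (s : CovariantRep γ) :
    FreeStarAlgebra (X ⊕ Y) →⋆ₐ[ℂ] Op (r.idx × s.idx) :=
  FreeStarAlgebra.lift (Sum.elim (fun x => amplify r.idx s.idx (r.rep x))
    fun y => braidedAmplify ζ r.deg s.deg (s.rep y))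

theorem pairRep_inl (r : CovariantRep β) (s : CovariantRep γ) (x : X) :
    pairRep ζ r s (.of (.inl x)) = amplify r.idx s.idx (r.rep x) := FreeStarAlgebra.lift_of _ _

theorem pairRep_inr (r : CovariantRep β) (s : CovariantRep γ) (y : Y) :
    pairRep ζ r s (.of (.inr y)) = braidedAmplify ζ r.deg s.deg (s.rep y) :=
  FreeStarAlgebra.lift_of _ _

theorem pairRep_bddAbove (w : FreeStarAlgebra (X ⊕ Y)) : BddAbove (Set.range
    fun i : CovariantRep β × CovariantRep γ => ‖pairRep ζ i.1 i.2 w‖) := by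
  refine FreeStarAlgebra.bddAbove (fun i : CovariantRep β × CovariantRep γ => pairRep ζ i.1 i.2)
    (Sum.elim norm norm) (fun i x => ?_) w
  rw [pairRep, FreeStarAlgebra.lift_of]
  cases x with
  | inl x => exact NonUnitalStarAlgHom.norm_apply_le ((amplify _ _).comp i.1.rep) x
  | inr y => exact NonUnitalStarAlgHom.norm_apply_le ((braidedAmplify _ _ _).comp i.2.rep) y

/-- The spatial braided tensor product `X ⊠_ζ Y`: the C*-algebra generated by the operators
`x ⊗ 1` and `Ψ (y ⊗ 1) Ψ*` on `H ⊗ K`, for covariant representations of `X` on `H` and of `Y`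
on `K`. The norm is the supremum over all pairs of covariant representations, and any pair of
faithful covariant representations attains it. -/
def BraidedTensor : Type :=
  (CStarSeminorm.ofFamily (fun i : CovariantRep β × CovariantRep γ => pairRep ζ i.1 i.2)
    (pairRep_bddAbove ζ β γ)).Completion

namespace BraidedTensor

instance : CStarAlgebra (BraidedTensor ζ β γ) :=
  inferInstanceAs (CStarAlgebra (CStarSeminorm.ofFamily
    (fun i : CovariantRep β × CovariantRep γ => pairRep ζ i.1 i.2)
    (pairRep_bddAbove ζ β γ)).Completion)

/-- The image of the free *-algebra. -/
def incl : FreeStarAlgebra (X ⊕ Y) →⋆ₐ[ℂ] BraidedTensor ζ β γ :=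
  (CStarSeminorm.ofFamily _ (pairRep_bddAbove ζ β γ)).incl

variable {β γ} in
/-- The representation of `X ⊠ Y` on `H ⊗ K` defined by covariant representations on `H`, `K`. -/
def eval (r : CovariantRep β) (s : CovariantRep γ) :
    BraidedTensor ζ β γ →⋆ₐ[ℂ] Op (r.idx × s.idx) :=
  CStarSeminorm.evalFamily _ (pairRep_bddAbove ζ β γ) (r, s)

theorem eval_incl (r : CovariantRep β) (s : CovariantRep γ) (w) :
    eval ζ r s (incl ζ β γ w) = pairRep ζ r s w :=
  CStarSeminorm.evalFamily_incl _ (pairRep_bddAbove ζ β γ) (r, s) w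

theorem norm_le {v : BraidedTensor ζ β γ} {C : ℝ} (hC : 0 ≤ C)
    (h : ∀ (r : CovariantRep β) (s : CovariantRep γ), ‖eval ζ r s v‖ ≤ C) : ‖v‖ ≤ C :=
  CStarSeminorm.norm_le_of_evalFamily _ (pairRep_bddAbove ζ β γ) v hC fun i => h i.1 i.2

theorem dense_incl : DenseRange (incl ζ β γ) :=
  (CStarSeminorm.ofFamily _ (pairRep_bddAbove ζ β γ)).dense_incl

/-- The canonical embedding of the first factor. -/
def j₁ : X →⋆ₐ[ℂ] BraidedTensor ζ β γ :=
  CStarSeminorm.homOfFamily _ (pairRep_bddAbove ζ β γ) (fun x => incl ζ β γ (.of (.inl x)))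
    (fun i => (amplify i.1.idx i.2.idx).comp i.1.rep)
    fun i _ => (eval_incl ζ β γ i.1 i.2 _).trans (FreeStarAlgebra.lift_of _ _)

/-- The canonical embedding of the second factor. -/
def j₂ : Y →⋆ₐ[ℂ] BraidedTensor ζ β γ :=
  CStarSeminorm.homOfFamily _ (pairRep_bddAbove ζ β γ) (fun y => incl ζ β γ (.of (.inr y)))
    (fun i => (braidedAmplify ζ i.1.deg i.2.deg).comp i.2.rep)
    fun i _ => (eval_incl ζ β γ i.1 i.2 _).trans (FreeStarAlgebra.lift_of _ _)

theorem incl_inl (x : X) : incl ζ β γ (.of (.inl x)) = j₁ ζ β γ x := rfl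
theorem incl_inr (y : Y) : incl ζ β γ (.of (.inr y)) = j₂ ζ β γ y := rfl

theorem eval_j₁ (r : CovariantRep β) (s : CovariantRep γ) (x : X) :
    eval ζ r s (j₁ ζ β γ x) = amplify r.idx s.idx (r.rep x) :=
  (eval_incl ζ β γ r s _).trans (FreeStarAlgebra.lift_of _ _)

theorem eval_j₂ (r : CovariantRep β) (s : CovariantRep γ) (y : Y) :
    eval ζ r s (j₂ ζ β γ y) = braidedAmplify ζ r.deg s.deg (s.rep y) :=
  (eval_incl ζ β γ r s _).trans (FreeStarAlgebra.lift_of _ _)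

variable {ζ β γ}

theorem hom_ext {D : Type*} [CStarAlgebra D] {f g : BraidedTensor ζ β γ →⋆ₐ[ℂ] D}
    (h1 : ∀ x, f (j₁ ζ β γ x) = g (j₁ ζ β γ x)) (h2 : ∀ y, f (j₂ ζ β γ y) = g (j₂ ζ β γ y)) :
    f = g := by
  have hfg : f.comp (incl ζ β γ) = g.comp (incl ζ β γ) :=
    FreeStarAlgebra.hom_ext fun x => by
      cases x with
      | inl x => exact h1 x
      | inr y => exact h2 y
  refine DFunLike.coe_injective ((dense_incl ζ β γ).equalizer (continuous_starAlgHom f) (continuous_starAlgHom g)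
    (funext fun w => DFunLike.congr_fun hfg w))

/-- *-homomorphisms out of the braided tensor product. -/
def lift {D : Type*} [CStarAlgebra D] (f : X →⋆ₐ[ℂ] D) (g : Y →⋆ₐ[ℂ] D)
    (h : ∀ w, ‖FreeStarAlgebra.lift (Sum.elim f g) w‖ ≤ ‖incl ζ β γ w‖) :
    BraidedTensor ζ β γ →⋆ₐ[ℂ] D :=
  CStarSeminorm.lift (CStarSeminorm.ofFamily _ (pairRep_bddAbove ζ β γ)) (FreeStarAlgebra.lift (Sum.elim f g)) fun w =>
    (h w).trans_eq (CStarSeminorm.norm_incl _ w)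

theorem lift_j₁ {D : Type*} [CStarAlgebra D] (f : X →⋆ₐ[ℂ] D) (g : Y →⋆ₐ[ℂ] D)
    (h : ∀ w, ‖FreeStarAlgebra.lift (Sum.elim f g) w‖ ≤ ‖incl ζ β γ w‖) (x : X) :
    lift f g h (j₁ ζ β γ x) = f x :=
  (CStarSeminorm.lift_incl _ _ _ _).trans (FreeStarAlgebra.lift_of _ _)

theorem lift_j₂ {D : Type*} [CStarAlgebra D] (f : X →⋆ₐ[ℂ] D) (g : Y →⋆ₐ[ℂ] D)
    (h : ∀ w, ‖FreeStarAlgebra.lift (Sum.elim f g) w‖ ≤ ‖incl ζ β γ w‖) (y : Y) :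
    lift f g h (j₂ ζ β γ y) = g y :=
  (CStarSeminorm.lift_incl _ _ _ _).trans (FreeStarAlgebra.lift_of _ _)

theorem norm_pairRep_le (r : CovariantRep β) (s : CovariantRep γ) (w) :
    ‖pairRep ζ r s w‖ ≤ ‖incl ζ β γ w‖ := by
  rw [← eval_incl]
  exact NonUnitalStarAlgHom.norm_apply_le (eval ζ r s) _

theorem eval_lift_map (f : X →⋆ₐ[ℂ] X') (hf : IsEquivariant β β' f) (g : Y →⋆ₐ[ℂ] Y')
    (hg : IsEquivariant γ γ' g) (r : CovariantRep β') (s : CovariantRep γ') :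
    (eval ζ r s).comp (FreeStarAlgebra.lift (Sum.elim ((j₁ ζ β' γ').comp f)
      ((j₂ ζ β' γ').comp g))) = pairRep ζ (r.pullback f hf) (s.pullback g hg) := by
  refine FreeStarAlgebra.hom_ext (Sum.rec (fun x => ?_) fun y => ?_)
  · refine Eq.trans ?_ (pairRep_inl ζ β γ (r.pullback f hf) (s.pullback g hg) x).symm
    refine Eq.trans ?_ (eval_j₁ ζ β' γ' r s (f x))
    exact congrArg (eval ζ r s) (FreeStarAlgebra.lift_of _ _)
  · refine Eq.trans ?_ (pairRep_inr ζ β γ (r.pullback f hf) (s.pullback g hg) y).symm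
    refine Eq.trans ?_ (eval_j₂ ζ β' γ' r s (g y))
    exact congrArg (eval ζ r s) (FreeStarAlgebra.lift_of _ _)

theorem map_aux (f : X →⋆ₐ[ℂ] X') (hf : IsEquivariant β β' f) (g : Y →⋆ₐ[ℂ] Y')
    (hg : IsEquivariant γ γ' g) (w : FreeStarAlgebra (X ⊕ Y)) :
    ‖FreeStarAlgebra.lift (Sum.elim ((j₁ ζ β' γ').comp f) ((j₂ ζ β' γ').comp g)) w‖ ≤
      ‖incl ζ β γ w‖ :=
  norm_le ζ β' γ' (norm_nonneg _) fun r s =>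
    (congrArg norm (DFunLike.congr_fun (eval_lift_map f hf g hg r s) w)).trans_le
      (norm_pairRep_le _ _ w)

/-- The *-homomorphism `f ⊠ g` for equivariant *-homomorphisms `f` and `g`. -/
def map (f : X →⋆ₐ[ℂ] X') (hf : IsEquivariant β β' f) (g : Y →⋆ₐ[ℂ] Y')
    (hg : IsEquivariant γ γ' g) : BraidedTensor ζ β γ →⋆ₐ[ℂ] BraidedTensor ζ β' γ' :=
  lift ((j₁ ζ β' γ').comp f) ((j₂ ζ β' γ').comp g) (map_aux f hf g hg)

theorem map_j₁ (f : X →⋆ₐ[ℂ] X') (hf : IsEquivariant β β' f) (g : Y →⋆ₐ[ℂ] Y')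
    (hg : IsEquivariant γ γ' g) (x : X) :
    map (ζ := ζ) f hf g hg (j₁ ζ β γ x) = j₁ ζ β' γ' (f x) := lift_j₁ _ _ _ x

theorem map_j₂ (f : X →⋆ₐ[ℂ] X') (hf : IsEquivariant β β' f) (g : Y →⋆ₐ[ℂ] Y')
    (hg : IsEquivariant γ γ' g) (y : Y) :
    map (ζ := ζ) f hf g hg (j₂ ζ β γ y) = j₂ ζ β' γ' (g y) := lift_j₂ _ _ _ y

variable (ζ β γ)

/-- The automorphism `β_z ⊠ γ_z`. -/
def diagAct (z : Circle) : BraidedTensor ζ β γ →⋆ₐ[ℂ] BraidedTensor ζ β γ :=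
  map (β.act z) (β.isEquivariant_act z) (γ.act z) (γ.isEquivariant_act z)

theorem continuous_diagAct (v : BraidedTensor ζ β γ) : Continuous fun z => diagAct ζ β γ z v := by
  have h0 (w : FreeStarAlgebra (X ⊕ Y)) : Continuous fun z => diagAct ζ β γ z (incl ζ β γ w) := by
    induction w using FreeStarAlgebra.induction with
    | h0 c =>
      simp only [AlgHomClass.commutes]
      exact continuous_const
    | h1 x =>
      cases x with
      | inl x =>
        simp only [incl_inl, diagAct, map_j₁, CircleAction.act_apply]
        exact (continuous_starAlgHom (j₁ ζ β γ)).comp (β.hom x).continuous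
      | inr y =>
        simp only [incl_inr, diagAct, map_j₂, CircleAction.act_apply]
        exact (continuous_starAlgHom (j₂ ζ β γ)).comp (γ.hom y).continuous
    | h1' x =>
      simp only [StarHomClass.map_star]
      refine Continuous.star ?_
      cases x with
      | inl x =>
        simp only [incl_inl, diagAct, map_j₁, CircleAction.act_apply]
        exact (continuous_starAlgHom (j₁ ζ β γ)).comp (β.hom x).continuous
      | inr y =>
        simp only [incl_inr, diagAct, map_j₂, CircleAction.act_apply]
        exact (continuous_starAlgHom (j₂ ζ β γ)).comp (γ.hom y).continuous
    | h2 a b ha hb =>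
      simp only [map_mul]
      exact ha.mul hb
    | h3 a b ha hb =>
      simp only [map_add]
      exact ha.add hb
  refine continuous_of_uniform_approx_of_continuous fun u hu => ?_
  obtain ⟨ε, hε, hu⟩ := Metric.mem_uniformity_dist.mp hu
  obtain ⟨w, hw⟩ := Metric.denseRange_iff.mp (dense_incl ζ β γ) v ε hε
  refine ⟨_, h0 w, fun z => hu ?_⟩
  rw [dist_eq_norm, ← map_sub]
  rw [dist_eq_norm] at hw
  exact (NonUnitalStarAlgHom.norm_apply_le (diagAct ζ β γ z) _).trans_lt hw

/-- The diagonal circle action on the braided tensor product. -/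
def action : CircleAction (BraidedTensor ζ β γ) where
  hom :=
    { toFun := fun v => ⟨fun z => diagAct ζ β γ z v, continuous_diagAct ζ β γ v⟩
      map_one' := ContinuousMap.ext fun z => map_one (diagAct ζ β γ z)
      map_mul' := fun v w => ContinuousMap.ext fun z => map_mul (diagAct ζ β γ z) v w
      map_zero' := ContinuousMap.ext fun z => map_zero (diagAct ζ β γ z)
      map_add' := fun v w => ContinuousMap.ext fun z => map_add (diagAct ζ β γ z) v w
      commutes' := fun c => ContinuousMap.ext fun z => AlgHomClass.commutes (diagAct ζ β γ z) c
      map_star' := fun v => ContinuousMap.ext fun z => StarHomClass.map_star (diagAct ζ β γ z) v }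
  hom_one v := by
    have : diagAct ζ β γ 1 = StarAlgHom.id ℂ _ := hom_ext
      (fun x => by simp [diagAct, map_j₁, CircleAction.act_apply, CircleAction.hom_one])
      (fun y => by simp [diagAct, map_j₂, CircleAction.act_apply, CircleAction.hom_one])
    exact DFunLike.congr_fun this v
  hom_mul z w v := by
    have : diagAct ζ β γ (z * w) = (diagAct ζ β γ z).comp (diagAct ζ β γ w) := hom_ext
      (fun x => by simp [diagAct, map_j₁, CircleAction.act_apply, CircleAction.hom_mul])
      (fun y => by simp [diagAct, map_j₂, CircleAction.act_apply, CircleAction.hom_mul])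
    exact DFunLike.congr_fun this v

theorem action_act (z : Circle) (v : BraidedTensor ζ β γ) :
    (action ζ β γ).act z v = diagAct ζ β γ z v := rfl

end BraidedTensor

end Tensor

end

noncomputable section

section Hilbert

variable {ι κ μ : Type*}

theorem circleRep_amplify (l : ι → ℤ) (m : κ → ℤ) (z : Circle) (S T : Op ι)
    (h : ∀ ξ, circleRep l z (S ξ) = T (circleRep l z ξ)) (f : ℓ²(ι × κ, ℂ)) :
    circleRep (fun x : ι × κ => l x.1 + m x.2) z (amplify ι κ S f) =
      amplify ι κ T (circleRep (fun x : ι × κ => l x.1 + m x.2) z f) := by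
  refine lp.ext (funext fun ⟨a, b⟩ => ?_)
  have h1 : sliceEquiv ι κ (circleRep (fun x : ι × κ => l x.1 + m x.2) z f) b =
      ((z ^ m b : Circle) : ℂ) • circleRep l z (sliceEquiv ι κ f b) := by
    refine lp.ext (funext fun a => ?_)
    rw [sliceEquiv_apply, circleRep_apply, lp.coeFn_smul, Pi.smul_apply, circleRep_apply,
      sliceEquiv_apply, zpow_add, Circle.coe_mul, smul_eq_mul]
    ring
  rw [circleRep_apply, amplify_apply, amplify_apply, h1, Op.map_smul, ← h, lp.coeFn_smul,
    Pi.smul_apply, circleRep_apply, zpow_add, Circle.coe_mul, smul_eq_mul]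
  ring

theorem circleRep_braidedAmplify (ζ : Circle) (l : ι → ℤ) (m : κ → ℤ) (z : Circle)
    (S T : Op κ) (h : ∀ ξ, circleRep m z (S ξ) = T (circleRep m z ξ))
    (f : ℓ²(ι × κ, ℂ)) :
    circleRep (fun x : ι × κ => l x.1 + m x.2) z (braidedAmplify ζ l m S f) =
      braidedAmplify ζ l m T (circleRep (fun x : ι × κ => l x.1 + m x.2) z f) := by
  refine lp.ext (funext fun ⟨a, b⟩ => ?_)
  have h1 : sliceEquiv κ ι ((braiding ζ l m).symm
        (circleRep (fun x : ι × κ => l x.1 + m x.2) z f)) a =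
      ((z ^ l a : Circle) : ℂ) •
        circleRep m z (sliceEquiv κ ι ((braiding ζ l m).symm f) a) := by
    refine lp.ext (funext fun b => ?_)
    rw [slice_braiding_symm, circleRep_apply, lp.coeFn_smul, Pi.smul_apply, circleRep_apply,
      slice_braiding_symm, zpow_add, Circle.coe_mul, smul_eq_mul]
    ring
  rw [circleRep_apply, braidedAmplify_apply, braidedAmplify_apply, h1, Op.map_smul, ← h,
    lp.coeFn_smul, Pi.smul_apply, circleRep_apply, zpow_add, Circle.coe_mul, smul_eq_mul]
  ring

/-- The unitary `ℓ²(ι × (κ × μ)) ≅ ℓ²((ι × κ) × μ)`. -/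
def assocUnitary (ι κ μ : Type*) : ℓ²(ι × κ × μ, ℂ) ≃ₗᵢ[ℂ] ℓ²((ι × κ) × μ, ℂ) :=
  phaseReindex (Equiv.prodAssoc ι κ μ).symm fun _ => 1

theorem conj_assoc_apply (T : Op (ι × κ × μ)) (f : ℓ²((ι × κ) × μ, ℂ))
    (a : ι) (b : κ) (c : μ) : Op.conj (assocUnitary ι κ μ) T f ((a, b), c) =
      T ((assocUnitary ι κ μ).symm f) (a, b, c) :=
  one_mul _

theorem assocUnitary_symm_apply (f : ℓ²((ι × κ) × μ, ℂ)) (a : ι) (b : κ) (c : μ) :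
    (assocUnitary ι κ μ).symm f (a, b, c) = f ((a, b), c) := by
  change ((1 : Circle) : ℂ)⁻¹ * f ((a, b), c) = _
  simp

theorem conj_assoc_amplify (S : Op ι) :
    amplify (ι × κ) μ (amplify ι κ S) =
      Op.conj (assocUnitary ι κ μ) (amplify ι (κ × μ) S) := by
  refine DFunLike.ext _ _ fun f => lp.ext (funext fun ⟨⟨a, b⟩, c⟩ => ?_)
  rw [conj_assoc_apply, amplify_apply, amplify_apply, amplify_apply]
  have h : sliceEquiv ι κ (sliceEquiv (ι × κ) μ f c) b =
      sliceEquiv ι (κ × μ) ((assocUnitary ι κ μ).symm f) (b, c) := by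
    refine lp.ext (funext fun a => ?_)
    rw [sliceEquiv_apply, sliceEquiv_apply, sliceEquiv_apply, assocUnitary_symm_apply]
  rw [h]

theorem conj_assoc_braided_amplify (ζ : Circle) (l : ι → ℤ) (m : κ → ℤ) (k : μ → ℤ)
    (S : Op κ) :
    amplify (ι × κ) μ (braidedAmplify ζ l m S) =
      Op.conj (assocUnitary ι κ μ)
        (braidedAmplify ζ l (fun x : κ × μ => m x.1 + k x.2) (amplify κ μ S)) := by
  refine DFunLike.ext _ _ fun f => lp.ext (funext fun ⟨⟨a, b⟩, c⟩ => ?_)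
  rw [conj_assoc_apply, amplify_apply, braidedAmplify_apply, braidedAmplify_apply, amplify_apply]
  have h : sliceEquiv κ μ (sliceEquiv (κ × μ) ι ((braiding ζ l fun x : κ × μ => m x.1 + k x.2).symm
        ((assocUnitary ι κ μ).symm f)) a) c =
      ((ζ ^ (l a * k c) : Circle) : ℂ)⁻¹ •
        sliceEquiv κ ι ((braiding ζ l m).symm (sliceEquiv (ι × κ) μ f c)) a := by
    refine lp.ext (funext fun b => ?_)
    rw [lp.coeFn_smul, Pi.smul_apply, smul_eq_mul, sliceEquiv_apply, slice_braiding_symm,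
      slice_braiding_symm, assocUnitary_symm_apply, sliceEquiv_apply, mul_add, zpow_add,
      Circle.coe_mul, mul_inv]
    ring
  rw [h, Op.map_smul, lp.coeFn_smul, Pi.smul_apply, smul_eq_mul, mul_add, zpow_add, Circle.coe_mul,
    mul_assoc, mul_inv_cancel_left₀ (Circle.coe_ne_zero _)]

theorem conj_assoc_braided_braided (ζ : Circle) (l : ι → ℤ) (m : κ → ℤ) (k : μ → ℤ)
    (S : Op μ) :
    braidedAmplify ζ (fun x : ι × κ => l x.1 + m x.2) k S =
      Op.conj (assocUnitary ι κ μ)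
        (braidedAmplify ζ l (fun x : κ × μ => m x.1 + k x.2) (braidedAmplify ζ m k S)) := by
  refine DFunLike.ext _ _ fun f => lp.ext (funext fun ⟨⟨a, b⟩, c⟩ => ?_)
  rw [conj_assoc_apply, braidedAmplify_apply, braidedAmplify_apply, braidedAmplify_apply]
  have h : sliceEquiv μ κ ((braiding ζ m k).symm (sliceEquiv (κ × μ) ι
        ((braiding ζ l fun x : κ × μ => m x.1 + k x.2).symm
        ((assocUnitary ι κ μ).symm f)) a)) b =
      ((ζ ^ (l a * m b) : Circle) : ℂ)⁻¹ •
        sliceEquiv μ (ι × κ) ((braiding ζ (fun x : ι × κ => l x.1 + m x.2) k).symm f) (a, b) := by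
    refine lp.ext (funext fun c => ?_)
    rw [lp.coeFn_smul, Pi.smul_apply, smul_eq_mul, slice_braiding_symm, slice_braiding_symm,
      slice_braiding_symm, assocUnitary_symm_apply, mul_add, add_mul, zpow_add, zpow_add,
      Circle.coe_mul, Circle.coe_mul, mul_inv, mul_inv]
    ring
  have h0 : ((ζ ^ (l a * m b) : Circle) : ℂ) ≠ 0 := Circle.coe_ne_zero _
  rw [h, Op.map_smul, lp.coeFn_smul, Pi.smul_apply, smul_eq_mul, mul_add, add_mul, zpow_add, zpow_add,
    Circle.coe_mul, Circle.coe_mul]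
  field_simp

end Hilbert

section Prod

variable {X Y : Type} [CStarAlgebra X] [CStarAlgebra Y] {β : CircleAction X} {γ : CircleAction Y}

theorem BraidedTensor.eval_covariant (ζ : Circle) (r : CovariantRep β) (s : CovariantRep γ)
    (z : Circle) (v : BraidedTensor ζ β γ) (ξ : ℓ²(r.idx × s.idx, ℂ)) :
    circleRep (fun x : r.idx × s.idx => r.deg x.1 + s.deg x.2) z (eval ζ r s v ξ) =
      eval ζ r s ((action ζ β γ).act z v)
        (circleRep (fun x : r.idx × s.idx => r.deg x.1 + s.deg x.2) z ξ) := by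
  set ρ := circleRep (fun x : r.idx × s.idx => r.deg x.1 + s.deg x.2) z with hρ
  have key : (Op.conj ρ).comp (eval ζ r s) = (eval ζ r s).comp ((action ζ β γ).act z) := by
    refine hom_ext (fun x => ?_) fun y => ?_
    · refine DFunLike.ext _ _ fun ξ => ?_
      change ρ (eval ζ r s (j₁ ζ β γ x) (ρ.symm ξ)) =
        eval ζ r s (diagAct ζ β γ z (j₁ ζ β γ x)) ξ
      rw [diagAct, map_j₁, eval_j₁, eval_j₁, hρ,
        circleRep_amplify _ _ _ _ (r.rep (β.act z x)) (r.covariant z x)]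
      rw [LinearIsometryEquiv.apply_symm_apply]
    · refine DFunLike.ext _ _ fun ξ => ?_
      change ρ (eval ζ r s (j₂ ζ β γ y) (ρ.symm ξ)) =
        eval ζ r s (diagAct ζ β γ z (j₂ ζ β γ y)) ξ
      rw [diagAct, map_j₂, eval_j₂, eval_j₂, hρ,
        circleRep_braidedAmplify _ _ _ _ _ (s.rep (γ.act z y)) (s.covariant z y)]
      rw [LinearIsometryEquiv.apply_symm_apply]
  have h := DFunLike.congr_fun (DFunLike.congr_fun key v) (ρ ξ)
  change ρ (eval ζ r s v (ρ.symm (ρ ξ))) = _ at h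
  rwa [LinearIsometryEquiv.symm_apply_apply] at h

/-- The covariant representation of `X ⊠ Y` on the tensor product of two Hilbert spaces. -/
def CovariantRep.prod (ζ : Circle) (r : CovariantRep β) (s : CovariantRep γ) :
    CovariantRep (BraidedTensor.action ζ β γ) where
  idx := r.idx × s.idx
  deg x := r.deg x.1 + s.deg x.2
  rep := BraidedTensor.eval ζ r s
  covariant := BraidedTensor.eval_covariant ζ r s

end Prod

/-! ### The threefold braided tensor product -/

section Triple

variable {X Y Z : Type} [CStarAlgebra X] [CStarAlgebra Y] [CStarAlgebra Z]
  (ζ : Circle) (β : CircleAction X) (γ : CircleAction Y) (δ : CircleAction Z)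

variable {β γ δ} in
/-- The representation of the free *-algebra on `X ⊔ Y ⊔ Z` on `ℓ²(r) ⊗ ℓ²(s) ⊗ ℓ²(t)` by
`x ↦ x ⊗ 1 ⊗ 1`, `y ↦ Ψ (y ⊗ 1) Ψ* ⊗ 1` and `z ↦ Ψ (z ⊗ 1 ⊗ 1) Ψ*`. -/
def tripleRep (r : CovariantRep β) (s : CovariantRep γ) (t : CovariantRep δ) :
    FreeStarAlgebra (X ⊕ Y ⊕ Z) →⋆ₐ[ℂ]
      Op ((r.idx × s.idx) × t.idx) :=
  FreeStarAlgebra.lift (Sum.elim (fun x => amplify _ t.idx (amplify r.idx s.idx (r.rep x)))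
    (Sum.elim (fun y => amplify _ t.idx (braidedAmplify ζ r.deg s.deg (s.rep y)))
      fun z => braidedAmplify ζ (fun x : r.idx × s.idx => r.deg x.1 + s.deg x.2) t.deg (t.rep z)))

theorem tripleRep_bddAbove (w : FreeStarAlgebra (X ⊕ Y ⊕ Z)) : BddAbove (Set.range
    fun i : CovariantRep β × CovariantRep γ × CovariantRep δ =>
      ‖tripleRep ζ i.1 i.2.1 i.2.2 w‖) := by
  refine FreeStarAlgebra.bddAbove
    (fun i : CovariantRep β × CovariantRep γ × CovariantRep δ => tripleRep ζ i.1 i.2.1 i.2.2)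
    (Sum.elim norm (Sum.elim norm norm)) (fun i x => ?_) w
  rw [tripleRep, FreeStarAlgebra.lift_of]
  rcases x with x | y | z
  · exact NonUnitalStarAlgHom.norm_apply_le
      ((amplify _ _).comp ((amplify _ _).comp i.1.rep)) x
  · exact NonUnitalStarAlgHom.norm_apply_le
      ((amplify _ _).comp ((braidedAmplify _ _ _).comp i.2.1.rep)) y
  · exact NonUnitalStarAlgHom.norm_apply_le ((braidedAmplify _ _ _).comp i.2.2.rep) z

/-- The spatial braided tensor product `X ⊠_ζ Y ⊠_ζ Z`. -/
def BraidedTriple : Type :=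
  (CStarSeminorm.ofFamily (fun i : CovariantRep β × CovariantRep γ × CovariantRep δ =>
    tripleRep ζ i.1 i.2.1 i.2.2) (tripleRep_bddAbove ζ β γ δ)).Completion

namespace BraidedTriple

instance : CStarAlgebra (BraidedTriple ζ β γ δ) :=
  inferInstanceAs (CStarAlgebra (CStarSeminorm.ofFamily
    (fun i : CovariantRep β × CovariantRep γ × CovariantRep δ => tripleRep ζ i.1 i.2.1 i.2.2)
    (tripleRep_bddAbove ζ β γ δ)).Completion)

/-- The image of the free *-algebra. -/
def incl : FreeStarAlgebra (X ⊕ Y ⊕ Z) →⋆ₐ[ℂ] BraidedTriple ζ β γ δ :=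
  (CStarSeminorm.ofFamily _ (tripleRep_bddAbove ζ β γ δ)).incl

variable {β γ δ} in
/-- The representation on the tensor product of three Hilbert spaces. -/
def eval (r : CovariantRep β) (s : CovariantRep γ) (t : CovariantRep δ) :
    BraidedTriple ζ β γ δ →⋆ₐ[ℂ]
      Op ((r.idx × s.idx) × t.idx) :=
  CStarSeminorm.evalFamily _ (tripleRep_bddAbove ζ β γ δ) (r, s, t)

theorem eval_incl (r : CovariantRep β) (s : CovariantRep γ) (t : CovariantRep δ) (w) :
    eval ζ r s t (incl ζ β γ δ w) = tripleRep ζ r s t w :=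
  CStarSeminorm.evalFamily_incl _ (tripleRep_bddAbove ζ β γ δ) (r, s, t) w

theorem norm_le {v : BraidedTriple ζ β γ δ} {C : ℝ} (hC : 0 ≤ C)
    (h : ∀ (r : CovariantRep β) (s : CovariantRep γ) (t : CovariantRep δ),
      ‖eval ζ r s t v‖ ≤ C) : ‖v‖ ≤ C :=
  CStarSeminorm.norm_le_of_evalFamily
    (fun i : CovariantRep β × CovariantRep γ × CovariantRep δ => tripleRep ζ i.1 i.2.1 i.2.2)
    (tripleRep_bddAbove ζ β γ δ) v hC fun ⟨r, s, t⟩ => h r s t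

/-- The canonical embedding of the first factor. -/
def j₁ : X →⋆ₐ[ℂ] BraidedTriple ζ β γ δ :=
  CStarSeminorm.homOfFamily _ (tripleRep_bddAbove ζ β γ δ)
    (fun x => incl ζ β γ δ (.of (.inl x)))
    (fun i => (amplify _ i.2.2.idx).comp ((amplify i.1.idx i.2.1.idx).comp i.1.rep))
    fun i _ => (eval_incl ζ β γ δ i.1 i.2.1 i.2.2 _).trans (FreeStarAlgebra.lift_of _ _)

/-- The canonical embedding of the second factor. -/
def j₂ : Y →⋆ₐ[ℂ] BraidedTriple ζ β γ δ :=
  CStarSeminorm.homOfFamily _ (tripleRep_bddAbove ζ β γ δ)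
    (fun y => incl ζ β γ δ (.of (.inr (.inl y))))
    (fun i => (amplify _ i.2.2.idx).comp ((braidedAmplify ζ i.1.deg i.2.1.deg).comp i.2.1.rep))
    fun i _ => (eval_incl ζ β γ δ i.1 i.2.1 i.2.2 _).trans (FreeStarAlgebra.lift_of _ _)

/-- The canonical embedding of the third factor. -/
def j₃ : Z →⋆ₐ[ℂ] BraidedTriple ζ β γ δ :=
  CStarSeminorm.homOfFamily _ (tripleRep_bddAbove ζ β γ δ)
    (fun z => incl ζ β γ δ (.of (.inr (.inr z))))
    (fun i => (braidedAmplify ζ (fun x : i.1.idx × i.2.1.idx => i.1.deg x.1 + i.2.1.deg x.2)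
      i.2.2.deg).comp i.2.2.rep)
    fun i _ => (eval_incl ζ β γ δ i.1 i.2.1 i.2.2 _).trans (FreeStarAlgebra.lift_of _ _)

variable {β γ δ}

theorem eval_j₁ (r : CovariantRep β) (s : CovariantRep γ) (t : CovariantRep δ) (x : X) :
    eval ζ r s t (j₁ ζ β γ δ x) = amplify _ t.idx (amplify r.idx s.idx (r.rep x)) :=
  (eval_incl ζ β γ δ r s t _).trans (FreeStarAlgebra.lift_of _ _)

theorem eval_j₂ (r : CovariantRep β) (s : CovariantRep γ) (t : CovariantRep δ) (y : Y) :
    eval ζ r s t (j₂ ζ β γ δ y) = amplify _ t.idx (braidedAmplify ζ r.deg s.deg (s.rep y)) :=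
  (eval_incl ζ β γ δ r s t _).trans (FreeStarAlgebra.lift_of _ _)

theorem eval_j₃ (r : CovariantRep β) (s : CovariantRep γ) (t : CovariantRep δ) (z : Z) :
    eval ζ r s t (j₃ ζ β γ δ z) =
      braidedAmplify ζ (fun x : r.idx × s.idx => r.deg x.1 + s.deg x.2) t.deg (t.rep z) :=
  (eval_incl ζ β γ δ r s t _).trans (FreeStarAlgebra.lift_of _ _)

theorem j₁₂_aux (w : FreeStarAlgebra (X ⊕ Y)) :
    ‖FreeStarAlgebra.lift (Sum.elim (j₁ ζ β γ δ) (j₂ ζ β γ δ)) w‖ ≤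
      ‖BraidedTensor.incl ζ β γ w‖ := by
  refine norm_le ζ β γ δ (norm_nonneg _) fun r s t => ?_
  have h : (eval ζ r s t).comp (FreeStarAlgebra.lift (Sum.elim (j₁ ζ β γ δ) (j₂ ζ β γ δ))) =
      (amplify (r.idx × s.idx) t.idx).comp (pairRep ζ r s) := by
    refine FreeStarAlgebra.hom_ext (Sum.rec (fun x => ?_) fun y => ?_)
    · exact (congrArg (eval ζ r s t) (FreeStarAlgebra.lift_of _ _)).trans ((eval_j₁ ζ r s t x).trans
        (congrArg (amplify _ _) (pairRep_inl ζ β γ r s x).symm))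
    · exact (congrArg (eval ζ r s t) (FreeStarAlgebra.lift_of _ _)).trans ((eval_j₂ ζ r s t y).trans
        (congrArg (amplify _ _) (pairRep_inr ζ β γ r s y).symm))
  exact (congrArg norm (DFunLike.congr_fun h w)).trans_le
    ((NonUnitalStarAlgHom.norm_apply_le (amplify (r.idx × s.idx) t.idx) _).trans
      (BraidedTensor.norm_pairRep_le r s w))

/-- The canonical embedding `X ⊠ Y → X ⊠ Y ⊠ Z` of the first two factors. -/
def j₁₂ : BraidedTensor ζ β γ →⋆ₐ[ℂ] BraidedTriple ζ β γ δ :=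
  BraidedTensor.lift (j₁ ζ β γ δ) (j₂ ζ β γ δ) (j₁₂_aux ζ)

theorem eval_j₁₂ (r : CovariantRep β) (s : CovariantRep γ) (t : CovariantRep δ) :
    (eval ζ r s t).comp (j₁₂ ζ) =
      (amplify (r.idx × s.idx) t.idx).comp (BraidedTensor.eval ζ r s) := by
  refine BraidedTensor.hom_ext (fun x => ?_) fun y => ?_
  · exact (congrArg (eval ζ r s t) (BraidedTensor.lift_j₁ _ _ (j₁₂_aux ζ) x)).trans ((eval_j₁ ζ r s t x).trans
      (congrArg (amplify _ _) (BraidedTensor.eval_j₁ ζ β γ r s x).symm))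
  · exact (congrArg (eval ζ r s t) (BraidedTensor.lift_j₂ _ _ (j₁₂_aux ζ) y)).trans ((eval_j₂ ζ r s t y).trans
      (congrArg (amplify _ _) (BraidedTensor.eval_j₂ ζ β γ r s y).symm))

theorem j₂₃_aux (w : FreeStarAlgebra (Y ⊕ Z)) :
    ‖FreeStarAlgebra.lift (Sum.elim (j₂ ζ β γ δ) (j₃ ζ β γ δ)) w‖ ≤
      ‖BraidedTensor.incl ζ γ δ w‖ := by
  refine norm_le ζ β γ δ (norm_nonneg _) fun r s t => ?_
  have h : (eval ζ r s t).comp (FreeStarAlgebra.lift (Sum.elim (j₂ ζ β γ δ) (j₃ ζ β γ δ))) =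
      ((Op.conj (assocUnitary r.idx s.idx t.idx)).comp (braidedAmplify ζ r.deg
        fun x : s.idx × t.idx => s.deg x.1 + t.deg x.2)).comp (pairRep ζ s t) := by
    refine FreeStarAlgebra.hom_ext (Sum.rec (fun y => ?_) fun z => ?_)
    · exact (congrArg (eval ζ r s t) (FreeStarAlgebra.lift_of _ _)).trans ((eval_j₂ ζ r s t y).trans
        ((conj_assoc_braided_amplify ζ r.deg s.deg t.deg (s.rep y)).trans
        (congrArg ((Op.conj (assocUnitary r.idx s.idx t.idx)).comp (braidedAmplify ζ r.deg
        fun x : s.idx × t.idx => s.deg x.1 + t.deg x.2)) (pairRep_inl ζ γ δ s t y).symm)))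
    · exact (congrArg (eval ζ r s t) (FreeStarAlgebra.lift_of _ _)).trans ((eval_j₃ ζ r s t z).trans
        ((conj_assoc_braided_braided ζ r.deg s.deg t.deg (t.rep z)).trans
        (congrArg ((Op.conj (assocUnitary r.idx s.idx t.idx)).comp (braidedAmplify ζ r.deg
        fun x : s.idx × t.idx => s.deg x.1 + t.deg x.2)) (pairRep_inr ζ γ δ s t z).symm)))
  exact (congrArg norm (DFunLike.congr_fun h w)).trans_le
    ((NonUnitalStarAlgHom.norm_apply_le ((Op.conj (assocUnitary r.idx s.idx t.idx)).comp
      (braidedAmplify ζ r.deg fun x : s.idx × t.idx => s.deg x.1 + t.deg x.2)) _).trans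
      (BraidedTensor.norm_pairRep_le s t w))

/-- The canonical embedding `Y ⊠ Z → X ⊠ Y ⊠ Z` of the last two factors. -/
def j₂₃ : BraidedTensor ζ γ δ →⋆ₐ[ℂ] BraidedTriple ζ β γ δ :=
  BraidedTensor.lift (j₂ ζ β γ δ) (j₃ ζ β γ δ) (j₂₃_aux ζ)

theorem eval_j₂₃ (r : CovariantRep β) (s : CovariantRep γ) (t : CovariantRep δ) :
    (eval ζ r s t).comp (j₂₃ ζ) = ((Op.conj (assocUnitary r.idx s.idx t.idx)).comp
      (braidedAmplify ζ r.deg fun x : s.idx × t.idx => s.deg x.1 + t.deg x.2)).comp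
        (BraidedTensor.eval ζ s t) := by
  refine BraidedTensor.hom_ext (fun y => ?_) fun z => ?_
  · exact (congrArg (eval ζ r s t) (BraidedTensor.lift_j₁ _ _ (j₂₃_aux ζ) y)).trans ((eval_j₂ ζ r s t y).trans
      ((conj_assoc_braided_amplify ζ r.deg s.deg t.deg (s.rep y)).trans
      (congrArg ((Op.conj (assocUnitary r.idx s.idx t.idx)).comp (braidedAmplify ζ r.deg
      fun x : s.idx × t.idx => s.deg x.1 + t.deg x.2)) (BraidedTensor.eval_j₁ ζ γ δ s t y).symm)))
  · exact (congrArg (eval ζ r s t) (BraidedTensor.lift_j₂ _ _ (j₂₃_aux ζ) z)).trans ((eval_j₃ ζ r s t z).trans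
      ((conj_assoc_braided_braided ζ r.deg s.deg t.deg (t.rep z)).trans
      (congrArg ((Op.conj (assocUnitary r.idx s.idx t.idx)).comp (braidedAmplify ζ r.deg
      fun x : s.idx × t.idx => s.deg x.1 + t.deg x.2)) (BraidedTensor.eval_j₂ ζ γ δ s t z).symm)))

theorem ofLeft_aux (w : FreeStarAlgebra (BraidedTensor ζ β γ ⊕ Z)) :
    ‖FreeStarAlgebra.lift (Sum.elim (j₁₂ ζ (δ := δ)) (j₃ ζ β γ δ)) w‖ ≤
      ‖BraidedTensor.incl ζ (BraidedTensor.action ζ β γ) δ w‖ := by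
  refine norm_le ζ β γ δ (norm_nonneg _) fun r s t => ?_
  have h : (eval ζ r s t).comp (FreeStarAlgebra.lift (Sum.elim (j₁₂ ζ) (j₃ ζ β γ δ))) =
      pairRep ζ (r.prod ζ s) t := by
    refine FreeStarAlgebra.hom_ext (Sum.rec (fun v => ?_) fun z => ?_)
    · exact (congrArg (eval ζ r s t) (FreeStarAlgebra.lift_of _ _)).trans
        ((DFunLike.congr_fun (eval_j₁₂ ζ r s t) v).trans (pairRep_inl ζ _ _ (r.prod ζ s) t v).symm)
    · exact (congrArg (eval ζ r s t) (FreeStarAlgebra.lift_of _ _)).trans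
        ((eval_j₃ ζ r s t z).trans (pairRep_inr ζ _ _ (r.prod ζ s) t z).symm)
  exact (congrArg norm (DFunLike.congr_fun h w)).trans_le
    (BraidedTensor.norm_pairRep_le (r.prod ζ s) t w)

/-- The canonical identification `(X ⊠ Y) ⊠ Z → X ⊠ Y ⊠ Z`. -/
def ofLeft : BraidedTensor ζ (BraidedTensor.action ζ β γ) δ →⋆ₐ[ℂ] BraidedTriple ζ β γ δ :=
  BraidedTensor.lift (j₁₂ ζ) (j₃ ζ β γ δ) (ofLeft_aux ζ)

theorem ofRight_aux (w : FreeStarAlgebra (X ⊕ BraidedTensor ζ γ δ)) :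
    ‖FreeStarAlgebra.lift (Sum.elim (j₁ ζ β γ δ) (j₂₃ ζ (β := β))) w‖ ≤
      ‖BraidedTensor.incl ζ β (BraidedTensor.action ζ γ δ) w‖ := by
  refine norm_le ζ β γ δ (norm_nonneg _) fun r s t => ?_
  have h : (eval ζ r s t).comp (FreeStarAlgebra.lift (Sum.elim (j₁ ζ β γ δ) (j₂₃ ζ))) =
      (Op.conj (assocUnitary r.idx s.idx t.idx)).comp (pairRep ζ r (s.prod ζ t)) := by
    refine FreeStarAlgebra.hom_ext (Sum.rec (fun x => ?_) fun v => ?_)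
    · exact (congrArg (eval ζ r s t) (FreeStarAlgebra.lift_of _ _)).trans
        ((eval_j₁ ζ r s t x).trans ((conj_assoc_amplify (r.rep x)).trans
        (congrArg (Op.conj (assocUnitary r.idx s.idx t.idx))
          (pairRep_inl ζ _ _ r (s.prod ζ t) x).symm)))
    · exact (congrArg (eval ζ r s t) (FreeStarAlgebra.lift_of _ _)).trans
        ((DFunLike.congr_fun (eval_j₂₃ ζ r s t) v).trans
        (congrArg (Op.conj (assocUnitary r.idx s.idx t.idx))
          (pairRep_inr ζ _ _ r (s.prod ζ t) v).symm))
  exact (congrArg norm (DFunLike.congr_fun h w)).trans_le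
    ((NonUnitalStarAlgHom.norm_apply_le (Op.conj (assocUnitary r.idx s.idx t.idx)) _).trans
      (BraidedTensor.norm_pairRep_le r (s.prod ζ t) w))

/-- The canonical identification `X ⊠ (Y ⊠ Z) → X ⊠ Y ⊠ Z`. -/
def ofRight : BraidedTensor ζ β (BraidedTensor.action ζ γ δ) →⋆ₐ[ℂ] BraidedTriple ζ β γ δ :=
  BraidedTensor.lift (j₁ ζ β γ δ) (j₂₃ ζ) (ofRight_aux ζ)

end BraidedTriple

end Triple

/-! ### Braided compact quantum groups -/

/-- `(B, β, Δ)` is a braided compact quantum group over the circle: the comultiplication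
`Δ : B → B ⊠_ζ B` is equivariant, coassociative and satisfies the Podleś conditions. -/
structure IsBraidedCompactQuantumGroup (ζ : Circle) {B : Type} [CStarAlgebra B]
    (β : CircleAction B) (Δ : B →⋆ₐ[ℂ] BraidedTensor ζ β β) : Prop where
  equivariant : IsEquivariant β (BraidedTensor.action ζ β β) Δ
  coassoc : ∀ b,
    BraidedTriple.ofLeft ζ
      (BraidedTensor.map Δ equivariant (StarAlgHom.id ℂ B) (IsEquivariant.id β) (Δ b)) =
    BraidedTriple.ofRight ζ
      (BraidedTensor.map (StarAlgHom.id ℂ B) (IsEquivariant.id β) Δ equivariant (Δ b))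
  podles_right : (Submodule.span ℂ (Set.range fun x : B × B =>
    Δ x.1 * BraidedTensor.j₂ ζ β β x.2)).topologicalClosure = ⊤
  podles_left : (Submodule.span ℂ (Set.range fun x : B × B =>
    BraidedTensor.j₁ ζ β β x.1 * Δ x.2)).topologicalClosure = ⊤

end

/-- The coefficients `ω_ij` in `ω = ∑ ω_ij e_i ⊗ e_j`. -/
noncomputable def coeffMatrix {n : ℕ} {V : Type*} [AddCommGroup V] [Module ℂ V]
    (e : Module.Basis (Fin n) ℂ V) (ω : V ⊗[ℂ] V) : Matrix (Fin n) (Fin n) ℂ :=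
  fun i j => (e.tensorProduct e).repr ω (i, j)

/-! Everything on `A_o` is produced by its universal property: a matrix satisfying the defining
relations in a C*-algebra `D` yields a unital *-homomorphism `A_o → D`, because the norm pulled back
from `D` is one of the C*-seminorms whose supremum defines `A_o`. Uniqueness holds because
*-homomorphisms are continuous and the *-polynomials in the generators are dense.

The two hypotheses on `ω` enter through two consequences. Homogeneity says that `ω_ij ≠ 0` forces
`d_i + d_j = d`. The equation for `Ω̄ Ω` makes `Ω` invertible.

The degree condition makes the relations stable under `u_ij ↦ z ^ (d_j - d_i) u_ij`
(`BraidedOrthogonalRelations.twist`). These twisted generators are continuous in `z`, so they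
satisfy the relations in `C(𝕋, A_o)` and define the action, with `u_ij` homogeneous of degree `d_j -
d_i`.

In a braided tensor product, homogeneous elements of degrees `k` and `l` satisfy `j₂(y) j₁(x) = ζ ^
(k l) j₁(x) j₂(y)`; this is checked on basis vectors of graded Hilbert spaces
(`braidedAmplify_mul_amplify`). Given this rule, the powers of `ζ` in the invariance relation are
exactly those for which `∑ l, j₁(u_il) j₂(u_lk)` again satisfies the relations
(`BraidedOrthogonalRelations.braidedMul`). This gives `Δ`; equivariance and coassociativity are
comparisons on generators.

Invertibility of `Ω` is needed for the density statements: the invariance relation can be solved for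
`u_ij*`, so words in the `u_ij` alone span a dense subspace. Words are homogeneous, so `j₁(x)` and
`j₂(y)` can be interchanged up to a phase, and the products `j₁(x) j₂(y)` span densely. Unitarity of
`u` recovers `j₁(u_im)` from `Δ(u_ik) j₂(u_mk*)`, and `j₂(u_mk)` from `j₁(u_im*) Δ(u_ik)`; induction
on word length extends this to all words and proves both Podleś conditions. -/

noncomputable section

/-! ### The universal property of `A_o(V, π, ω)` -/

namespace CStarSeminorm

/-- The C*-seminorm `a ↦ ‖φ a‖` of a *-homomorphism to a C*-algebra. -/
def ofHom {A : Type*} [Ring A] [StarRing A] [Algebra ℂ A] {D : Type*} [CStarAlgebra D]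
    (φ : A →⋆ₐ[ℂ] D) : CStarSeminorm A where
  toFun a := ‖φ a‖
  map_zero' := by simp
  add_le' a b := by rw [map_add]; exact norm_add_le _ _
  neg' a := by simp
  smul' r a := by rw [map_smul, norm_smul]
  mul_le' a b := by rw [map_mul]; exact norm_mul_le _ _
  star_mul_self' a := by rw [map_mul, StarHomClass.map_star, CStarRing.norm_star_mul_self]

theorem incl_eq_incl_iff {A : Type*} [Ring A] [StarRing A] [Algebra ℂ A] (p : CStarSeminorm A)
    (a b : A) : p.incl a = p.incl b ↔ p.toSeminorm (a - b) = 0 := by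
  rw [← sub_eq_zero, ← map_sub, ← norm_eq_zero, norm_incl]

theorem incl_ofHom_eq_iff {A : Type*} [Ring A] [StarRing A] [Algebra ℂ A] {D : Type*}
    [CStarAlgebra D] (φ : A →⋆ₐ[ℂ] D) (a b : A) :
    (ofHom φ).incl a = (ofHom φ).incl b ↔ φ a = φ b := by
  rw [incl_eq_incl_iff, ← sub_eq_zero (a := φ a), ← map_sub]
  exact norm_eq_zero (a := φ (a - b))

end CStarSeminorm

/-! ### Transfer of the defining relations along *-homomorphisms -/

namespace BraidedOrthogonalRelations

variable {n : ℕ} {ζ : Circle} {d : ℤ} {deg : Fin n → ℤ} {Ω : Matrix (Fin n) (Fin n) ℂ}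
  {A B C : Type*} [Ring A] [StarRing A] [Algebra ℂ A] [Ring B] [StarRing B] [Algebra ℂ B]
  [Ring C] [StarRing C] [Algebra ℂ C]

/-- The defining relations transfer between the images of a matrix under two *-homomorphisms if
the second one identifies whatever the first one does. -/
theorem transfer (φ : A →⋆ₐ[ℂ] B) (ψ : A →⋆ₐ[ℂ] C) (h : ∀ a b, φ a = φ b → ψ a = ψ b)
    (u : Fin n → Fin n → A)
    (hu : BraidedOrthogonalRelations ζ d deg Ω fun i j => φ (u i j)) :
    BraidedOrthogonalRelations ζ d deg Ω fun i j => ψ (u i j) where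
  isometry i j := by
    -- Each relation equates the images of two *-polynomials in the entries of `u`, which is all
    -- that `h` carries over.
    have := h (∑ k, star (u k i) * u k j) (if i = j then 1 else 0) (by
      simpa [map_sum, StarHomClass.map_star, apply_ite φ] using hu.isometry i j)
    simpa [map_sum, StarHomClass.map_star, apply_ite ψ] using this
  coisometry i j := by
    have := h (∑ k, u i k * star (u j k)) (if i = j then 1 else 0) (by
      simpa [map_sum, StarHomClass.map_star, apply_ite φ] using hu.coisometry i j)
    simpa [map_sum, StarHomClass.map_star, apply_ite ψ] using this
  invariant i j := by
    have := h ((ζ : ℂ) ^ (deg j * deg i) • ∑ k, Ω i k • u j k)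
      ((ζ : ℂ) ^ (deg j * (d - deg j)) • ∑ k, Ω k j • star (u k i)) (by
      simpa only [map_sum, map_smul, StarHomClass.map_star] using hu.invariant i j)
    simpa only [map_sum, map_smul, StarHomClass.map_star] using this

theorem map (φ : A →⋆ₐ[ℂ] B) {u : Fin n → Fin n → A}
    (hu : BraidedOrthogonalRelations ζ d deg Ω u) :
    BraidedOrthogonalRelations ζ d deg Ω fun i j => φ (u i j) :=
  transfer (StarAlgHom.id ℂ A) φ (fun _ _ h => congrArg φ h) u hu

end BraidedOrthogonalRelations

/-! ### Relations, universal property and dense words in `A_o` -/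

namespace Ao

variable {n : ℕ} (ζ : Circle) (d : ℤ) (deg : Fin n → ℤ) (Ω : Matrix (Fin n) (Fin n) ℂ)

/-- The image of the free *-algebra. -/
def incl : FreeStarAlgebra (Fin n × Fin n) →⋆ₐ[ℂ] Ao ζ d deg Ω :=
  (AoMaxSeminorm ζ d deg Ω).incl

theorem dense_incl : DenseRange (incl ζ d deg Ω) := (AoMaxSeminorm ζ d deg Ω).dense_incl

theorem incl_of (i j : Fin n) : incl ζ d deg Ω (.of (i, j)) = u ζ d deg Ω i j := rfl

/-- The norm of `A_o` is the supremum over the admissible seminorms, so an identity between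
*-polynomials holds in `A_o` once it holds in the completion for each of them, where it is part of
admissibility. -/
theorem relations : BraidedOrthogonalRelations ζ d deg Ω (u ζ d deg Ω) := by
  have hb := FreeStarAlgebra.bddAbove (fun p : AoSeminorm ζ d deg Ω => p.1.incl) (fun _ => 1)
    fun p x => norm_le_one_of_isometry (fun i j => p.1.incl (.of (i, j))) p.2.isometry x.1 x.2
  have hext {a b : FreeStarAlgebra (Fin n × Fin n)}
      (h : ∀ p : AoSeminorm ζ d deg Ω, p.1.incl a = p.1.incl b) :
      incl ζ d deg Ω a = incl ζ d deg Ω b :=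
    CStarSeminorm.ext_evalFamily _ hb fun p =>
      (CStarSeminorm.evalFamily_incl _ hb p a).trans
        ((h p).trans (CStarSeminorm.evalFamily_incl _ hb p b).symm)
  constructor
  · intro i j
    have := hext (a := ∑ k, star (.of (k, i)) * .of (k, j)) (b := if i = j then 1 else 0) fun p => by
      simpa only [map_sum, map_mul, StarHomClass.map_star, apply_ite p.1.incl, map_one, map_zero]
        using p.2.isometry i j
    simpa only [map_sum, map_mul, StarHomClass.map_star, apply_ite (incl ζ d deg Ω), map_one,
      map_zero, incl_of] using this
  · intro i j
    have := hext (a := ∑ k, .of (i, k) * star (.of (j, k))) (b := if i = j then 1 else 0) fun p => by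
      simpa only [map_sum, map_mul, StarHomClass.map_star, apply_ite p.1.incl, map_one, map_zero]
        using p.2.coisometry i j
    simpa only [map_sum, map_mul, StarHomClass.map_star, apply_ite (incl ζ d deg Ω), map_one,
      map_zero, incl_of] using this
  · intro i j
    have := hext (a := (ζ : ℂ) ^ (deg j * deg i) • ∑ k, Ω i k • .of (j, k))
      (b := (ζ : ℂ) ^ (deg j * (d - deg j)) • ∑ k, Ω k j • star (.of (k, i))) fun p => by
      simpa only [map_sum, map_smul, StarHomClass.map_star] using p.2.invariant i j
    simpa only [map_sum, map_smul, StarHomClass.map_star, incl_of] using this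

variable {ζ d deg Ω}

section Lift

variable {D : Type*} [CStarAlgebra D]

theorem hom_ext {f g : Ao ζ d deg Ω →⋆ₐ[ℂ] D}
    (h : ∀ i j, f (u ζ d deg Ω i j) = g (u ζ d deg Ω i j)) : f = g := by
  have hfg : f.comp (incl ζ d deg Ω) = g.comp (incl ζ d deg Ω) :=
    FreeStarAlgebra.hom_ext fun x => h x.1 x.2
  exact DFunLike.coe_injective ((dense_incl ζ d deg Ω).equalizer (continuous_starAlgHom f)
    (continuous_starAlgHom g) (funext fun w => DFunLike.congr_fun hfg w))

theorem norm_lift_le (v : Fin n → Fin n → D) (hv : BraidedOrthogonalRelations ζ d deg Ω v)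
    (a : FreeStarAlgebra (Fin n × Fin n)) :
    ‖FreeStarAlgebra.lift (fun x => v x.1 x.2) a‖ ≤ (AoMaxSeminorm ζ d deg Ω).toSeminorm a := by
  set φ : FreeStarAlgebra (Fin n × Fin n) →⋆ₐ[ℂ] D := FreeStarAlgebra.lift fun x => v x.1 x.2
  have hφ : BraidedOrthogonalRelations ζ d deg Ω fun i j => φ (.of (i, j)) := by
    simpa only [φ, FreeStarAlgebra.lift_of] using hv
  -- The pulled-back norm `‖φ ·‖` is itself admissible: its completion identifies exactly the
  -- elements that `φ` identifies. Hence it lies below the supremum.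
  let p : AoSeminorm ζ d deg Ω := ⟨.ofHom φ, hφ.transfer φ (CStarSeminorm.ofHom φ).incl
    (fun a b h => (CStarSeminorm.incl_ofHom_eq_iff φ a b).mpr h) fun i j => .of (i, j)⟩
  have hb := FreeStarAlgebra.bddAbove (fun p : AoSeminorm ζ d deg Ω => p.1.incl) (fun _ => 1)
    fun p x => norm_le_one_of_isometry (fun i j => p.1.incl (.of (i, j))) p.2.isometry x.1 x.2
  have h1 : ‖φ a‖ = ‖p.1.incl a‖ := (CStarSeminorm.norm_incl p.1 a).symm
  rw [h1]
  exact le_ciSup (hb a) p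

/-- The universal property of `A_o`. -/
def lift (v : Fin n → Fin n → D) (hv : BraidedOrthogonalRelations ζ d deg Ω v) :
    Ao ζ d deg Ω →⋆ₐ[ℂ] D :=
  (AoMaxSeminorm ζ d deg Ω).lift (FreeStarAlgebra.lift fun x => v x.1 x.2) (norm_lift_le v hv)

theorem lift_u (v : Fin n → Fin n → D) (hv : BraidedOrthogonalRelations ζ d deg Ω v)
    (i j : Fin n) : lift v hv (u ζ d deg Ω i j) = v i j :=
  (CStarSeminorm.lift_incl _ _ _ _).trans (FreeStarAlgebra.lift_of _ _)

end Lift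

/-- If `Ω` is invertible, then the adjoints of the generators are linear combinations of the
generators. -/
theorem star_u_mem_span (hΩ : IsUnit Ω.det) (l i : Fin n) :
    star (u ζ d deg Ω l i) ∈
      Submodule.span ℂ (Set.range fun x : Fin n × Fin n => u ζ d deg Ω x.1 x.2) := by
  have h1 (j : Fin n) : ∑ k, Ω k j • star (u ζ d deg Ω k i) ∈
      Submodule.span ℂ (Set.range fun x : Fin n × Fin n => u ζ d deg Ω x.1 x.2) := by
    have hz : (ζ : ℂ) ^ (deg j * (d - deg j)) ≠ 0 := zpow_ne_zero _ (Circle.coe_ne_zero ζ)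
    -- The phase is nonzero, and after multiplication by it the sum is the side of the invariance
    -- relation that contains no adjoints.
    rw [← Submodule.smul_mem_iff _ hz, ← (relations ζ d deg Ω).invariant i j]
    exact Submodule.smul_mem _ _ (Submodule.sum_mem _ fun k _ => Submodule.smul_mem _ _
      (Submodule.subset_span ⟨(j, k), rfl⟩))
  -- For fixed `i` the sums in `h1` are the transpose of `Ω` applied to the vector `(u_ki*)_k`; the
  -- inverse undoes this.
  have h2 : star (u ζ d deg Ω l i) =
      ∑ j, Ω⁻¹ j l • ∑ k, Ω k j • star (u ζ d deg Ω k i) := by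
    have h3 (k : Fin n) : ∑ j, Ω⁻¹ j l * Ω k j = if k = l then 1 else 0 := by
      have := congrFun (congrFun (Matrix.mul_nonsing_inv Ω hΩ) k) l
      rw [Matrix.mul_apply, Matrix.one_apply] at this
      rw [← this]
      exact Finset.sum_congr rfl fun j _ => mul_comm _ _
    simp only [Finset.smul_sum, smul_smul]
    rw [Finset.sum_comm]
    simp only [← Finset.sum_smul, h3]
    simp
  rw [h2]
  exact Submodule.sum_mem _ fun j _ => Submodule.smul_mem _ _ (h1 j)

/-- The words in the generators. -/
def words (ζ : Circle) (d : ℤ) (deg : Fin n → ℤ) (Ω : Matrix (Fin n) (Fin n) ℂ) :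
    Submonoid (Ao ζ d deg Ω) :=
  Submonoid.closure (Set.range fun x : Fin n × Fin n => u ζ d deg Ω x.1 x.2)

/-- If `Ω` is invertible, then the words in the generators span a dense subspace. -/
theorem closure_span_words (hΩ : IsUnit Ω.det) :
    (Submodule.span ℂ (words ζ d deg Ω : Set (Ao ζ d deg Ω))).topologicalClosure = ⊤ := by
  rw [words, ← Algebra.adjoin_eq_span]
  set S := Algebra.adjoin ℂ (Set.range fun x : Fin n × Fin n => u ζ d deg Ω x.1 x.2)
  have hsub : Submodule.span ℂ (Set.range fun x : Fin n × Fin n => u ζ d deg Ω x.1 x.2) ≤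
      Subalgebra.toSubmodule S := Algebra.span_le_adjoin ℂ _
  -- `S` is generated without adjoints, yet it contains all *-polynomials because each `u_ij*` is
  -- already a linear combination of generators.
  have hmem (a : FreeStarAlgebra (Fin n × Fin n)) : incl ζ d deg Ω a ∈ S := by
    induction a using FreeStarAlgebra.induction with
    | h0 c => rw [AlgHomClass.commutes]; exact S.algebraMap_mem c
    | h1 x => exact Algebra.subset_adjoin ⟨x, rfl⟩
    | h1' x => rw [StarHomClass.map_star]; exact hsub (star_u_mem_span hΩ x.1 x.2)
    | h2 a b ha hb => rw [map_mul]; exact S.mul_mem ha hb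
    | h3 a b ha hb => rw [map_add]; exact S.add_mem ha hb
  rw [← Submodule.dense_iff_topologicalClosure_eq_top]
  refine (dense_incl ζ d deg Ω).mono ?_
  rintro _ ⟨a, rfl⟩
  exact hmem a

end Ao

end

noncomputable section

/-! ### Commutation relations in braided tensor products -/

section Hilbert

variable {ι κ : Type*}

theorem Op.ext_single [DecidableEq ι] {S T : Op ι}
    (h : ∀ a, S (lp.single 2 a 1) = T (lp.single 2 a 1)) : S = T := by
  refine DFunLike.ext _ _ fun f => ?_
  have hf := lp.hasSum_single (p := 2) (by norm_num) f
  have hs (R : Op ι) : HasSum (fun a => R (lp.single 2 a (f a))) (R f) :=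
    ContinuousLinearMap.hasSum (M := ℓ²(ι, ℂ)) (M₂ := ℓ²(ι, ℂ)) R hf
  have hS := hs S
  have he (a : ι) : lp.single 2 a (f a) = f a • (lp.single 2 a 1 : ℓ²(ι, ℂ)) := by
    rw [← lp.single_smul, smul_eq_mul, mul_one]
  simp only [he, Op.map_smul, h] at hS
  have hT := hs T
  simp only [he, Op.map_smul] at hT
  exact hS.unique hT

theorem sliceEquiv_smul_single [DecidableEq ι] [DecidableEq κ] (f : ℓ²(ι × κ, ℂ)) (a : ι) (b : κ)
    (c : ℂ) (h : ∀ a', f (a', b) = if a' = a then c else 0) :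
    sliceEquiv ι κ f b = c • (lp.single 2 a 1 : ℓ²(ι, ℂ)) := by
  refine lp.ext (funext fun a' => ?_)
  rw [sliceEquiv_apply, h, lp.coeFn_smul, Pi.smul_apply, lp.single_apply]
  by_cases ha : a' = a
  · subst ha; simp
  · simp [ha]

theorem circleRep_single [DecidableEq ι] (l : ι → ℤ) (z : Circle) (a : ι) :
    circleRep l z (lp.single 2 a 1 : ℓ²(ι, ℂ)) =
      ((z ^ l a : Circle) : ℂ) • (lp.single 2 a 1 : ℓ²(ι, ℂ)) := by
  refine lp.ext (funext fun b => ?_)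
  rw [circleRep_apply, lp.coeFn_smul, Pi.smul_apply, lp.single_apply, smul_eq_mul]
  by_cases hb : b = a
  · subst hb; rfl
  · simp [hb]

/-- An operator of degree `k` has a nonzero coefficient from `λ_a` to `λ_b` only if `l b = k + l a`.
The form with a free `z` avoids that case distinction: below, `z` is a power of `ζ`, and the
identity trades one exponent for another. -/
theorem matrixCoeff_of_homogeneous [DecidableEq ι] (l : ι → ℤ) (T : Op ι) (k : ℤ)
    (hT : ∀ z ξ, circleRep l z (T ξ) = ((z ^ k : Circle) : ℂ) • T (circleRep l z ξ))
    (z : Circle) (a b : ι) : ((z ^ l b : Circle) : ℂ) * T (lp.single 2 a 1) b =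
      ((z ^ (k + l a) : Circle) : ℂ) * T (lp.single 2 a 1) b := by
  have := congrArg (fun f : ℓ²(ι, ℂ) => f b) (hT z (lp.single 2 a 1))
  simp only [circleRep_apply, circleRep_single, Op.map_smul, lp.coeFn_smul, Pi.smul_apply,
    smul_eq_mul] at this
  rw [this, zpow_add, Circle.coe_mul, mul_assoc]

/-- The operators `x ⊗ 1` and `Ψ (y ⊗ 1) Ψ*` commute up to a phase if `x` and `y` are
homogeneous. -/
theorem braidedAmplify_mul_amplify (ζ : Circle) (l : ι → ℤ) (m : κ → ℤ) (T : Op ι) (S : Op κ)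
    (p q : ℤ) (hT : ∀ z ξ, circleRep l z (T ξ) = ((z ^ p : Circle) : ℂ) • T (circleRep l z ξ))
    (hS : ∀ z ξ, circleRep m z (S ξ) = ((z ^ q : Circle) : ℂ) • S (circleRep m z ξ)) :
    braidedAmplify ζ l m S * amplify ι κ T =
      ((ζ ^ (p * q) : Circle) : ℂ) • (amplify ι κ T * braidedAmplify ζ l m S) := by
  classical
  refine Op.ext_single fun ⟨a, b⟩ => lp.ext (funext fun ⟨a', b'⟩ => ?_)
  change braidedAmplify ζ l m S (amplify ι κ T (lp.single 2 (a, b) 1)) (a', b') =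
    ((ζ ^ (p * q) : Circle) : ℂ) *
      amplify ι κ T (braidedAmplify ζ l m S (lp.single 2 (a, b) 1)) (a', b')
  -- `T ⊗ 1` sends `λ_a ⊗ λ_b` to `T λ_a ⊗ λ_b`.
  have hA (x : ι) (y : κ) : amplify ι κ T (lp.single 2 (a, b) 1) (x, y) =
      if y = b then T (lp.single 2 a 1) x else 0 := by
    rw [amplify_apply, sliceEquiv_smul_single _ a y (if y = b then 1 else 0), Op.map_smul,
      lp.coeFn_smul, Pi.smul_apply, smul_eq_mul, ite_mul, one_mul, zero_mul]
    intro x'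
    rw [lp.single_apply]
    by_cases h1 : x' = a <;> by_cases h2 : y = b <;> simp [h1, h2]
  -- `Ψ (S ⊗ 1) Ψ*` sends `λ_a ⊗ λ_b` to `ζ ^ (l_a q) λ_a ⊗ S λ_b`: `Ψ*` contributes `ζ ^ (-l_a
  -- m_b)`, and `Ψ` contributes `ζ ^ (l_a (m_b + q))` since `S` raises the degree by `q`.
  have hB (x : ι) (y : κ) : braidedAmplify ζ l m S (lp.single 2 (a, b) 1) (x, y) =
      if x = a then ((ζ ^ (l a * q) : Circle) : ℂ) * S (lp.single 2 b 1) y else 0 := by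
    rw [braidedAmplify_apply, sliceEquiv_smul_single _ b x
      (if x = a then ((ζ ^ (l a * m b) : Circle) : ℂ)⁻¹ else 0), Op.map_smul,
      lp.coeFn_smul, Pi.smul_apply, smul_eq_mul]
    · by_cases hx : x = a
      · subst hx
        have := matrixCoeff_of_homogeneous m S q hS (ζ ^ l x) b y
        simp only [← zpow_mul, mul_add] at this
        rw [if_pos rfl, if_pos rfl, mul_left_comm, this, zpow_add, Circle.coe_mul]
        have h0 : ((ζ ^ (l x * m b) : Circle) : ℂ) ≠ 0 := Circle.coe_ne_zero _
        field_simp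
      · simp [hx]
    · intro y'
      refine (slice_braiding_symm ζ l m _ x y').trans ?_
      rw [lp.single_apply]
      by_cases h1 : x = a <;> by_cases h2 : y' = b <;> simp [h1, h2]
  rw [braidedAmplify_apply, amplify_apply, sliceEquiv_smul_single _ b a'
    (((ζ ^ (l a' * m b) : Circle) : ℂ)⁻¹ * T (lp.single 2 a 1) a'), sliceEquiv_smul_single _ a b'
    (((ζ ^ (l a * q) : Circle) : ℂ) * S (lp.single 2 b 1) b'), Op.map_smul, Op.map_smul,
    lp.coeFn_smul, lp.coeFn_smul, Pi.smul_apply, Pi.smul_apply, smul_eq_mul, smul_eq_mul]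
  -- The braided operator sees first-factor degree `l_a + p` if it acts after `T ⊗ 1`, and `l_a` if
  -- it acts before. The phases are `ζ ^ (q (l_a + p))` and `ζ ^ (q l_a)`, whose ratio is `ζ ^ (p
  -- q)`.
  · have h1 := matrixCoeff_of_homogeneous m S q hS (ζ ^ l a') b b'
    have h2 := matrixCoeff_of_homogeneous l T p hT (ζ ^ q) a a'
    simp only [← zpow_mul, zpow_add, Circle.coe_mul] at h1 h2
    have h0 : ((ζ ^ (l a' * m b) : Circle) : ℂ) ≠ 0 := Circle.coe_ne_zero _
    rw [mul_left_comm, h1, mul_comm (l a) q, mul_comm p q]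
    rw [mul_comm (l a') q]
    calc _ = ((ζ ^ (q * l a') : Circle) : ℂ) * T (lp.single 2 a 1) a' *
          S (lp.single 2 b 1) b' := by field_simp
      _ = _ := by rw [h2]; ring
  · intro x
    rw [hB]
  · intro y
    refine (slice_braiding_symm ζ l m _ a' y).trans ?_
    rw [hA]
    by_cases hy : y = b
    · subst hy; simp
    · simp [hy]

end Hilbert

/-- The element `x` is homogeneous of degree `k`. -/
def CircleAction.IsHomogeneous {B : Type} [CStarAlgebra B] (β : CircleAction B) (k : ℤ) (x : B) :
    Prop :=
  ∀ z, β.act z x = ((z ^ k : Circle) : ℂ) • x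

namespace CircleAction.IsHomogeneous

variable {B : Type} [CStarAlgebra B] {β : CircleAction B} {k l : ℤ} {x y : B}

theorem one : β.IsHomogeneous 0 1 := fun z => by simp

theorem mul (hx : β.IsHomogeneous k x) (hy : β.IsHomogeneous l y) :
    β.IsHomogeneous (k + l) (x * y) := fun z => by
  rw [map_mul, hx, hy, smul_mul_smul_comm, zpow_add, Circle.coe_mul]

theorem star (hx : β.IsHomogeneous k x) : β.IsHomogeneous (-k) (star x) := fun z => by
  rw [StarHomClass.map_star, hx, star_smul, zpow_neg, Circle.coe_inv_eq_conj]
  rfl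

theorem rep (hx : β.IsHomogeneous k x) (r : CovariantRep β) (z : Circle) (ξ : ℓ²(r.idx, ℂ)) :
    circleRep r.deg z (r.rep x ξ) = ((z ^ k : Circle) : ℂ) • r.rep x (circleRep r.deg z ξ) := by
  rw [r.covariant, hx, map_smul]
  rfl

end CircleAction.IsHomogeneous

namespace BraidedTensor

variable {X Y : Type} [CStarAlgebra X] [CStarAlgebra Y] {ζ : Circle} {β : CircleAction X}
  {γ : CircleAction Y}

theorem ext_eval {v w : BraidedTensor ζ β γ}
    (h : ∀ (r : CovariantRep β) (s : CovariantRep γ), eval ζ r s v = eval ζ r s w) : v = w := by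
  rw [← sub_eq_zero, ← norm_le_zero_iff]
  exact norm_le ζ β γ le_rfl fun r s => by rw [map_sub, h, sub_self, norm_zero]

/-- The commutation rule of the braided tensor product. Pairs of covariant representations separate
its elements, and in each pair the rule is the one for homogeneous operators. -/
theorem j₂_mul_j₁ {k l : ℤ} {x : X} {y : Y} (hx : β.IsHomogeneous k x)
    (hy : γ.IsHomogeneous l y) : j₂ ζ β γ y * j₁ ζ β γ x =
      ((ζ ^ (k * l) : Circle) : ℂ) • (j₁ ζ β γ x * j₂ ζ β γ y) :=
  ext_eval fun r s => by
    rw [map_smul, map_mul, map_mul, eval_j₁, eval_j₂]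
    exact braidedAmplify_mul_amplify ζ r.deg s.deg _ _ k l (hx.rep r) (hy.rep s)

end BraidedTensor

end

noncomputable section

/-! ### The circle action and the comultiplication -/

theorem Circle.star_coe_zpow (z : Circle) (k : ℤ) : star ((z : ℂ) ^ k) = (z : ℂ) ^ (-k) := by
  rw [← Circle.coe_zpow, ← Circle.coe_zpow, zpow_neg, Circle.coe_inv_eq_conj]
  rfl

/-- Evaluation at a point of the circle. -/
def evalCircle {B : Type*} [CStarAlgebra B] (z : Circle) : C(Circle, B) →⋆ₐ[ℂ] B where
  toFun f := f z
  map_one' := rfl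
  map_mul' _ _ := rfl
  map_zero' := rfl
  map_add' _ _ := rfl
  commutes' _ := rfl
  map_star' _ := rfl

theorem evalCircle_apply {B : Type*} [CStarAlgebra B] (z : Circle) (f : C(Circle, B)) :
    evalCircle z f = f z := rfl

/-! ### Stability of the relations under the circle and under braided products -/

section Relations

variable {n : ℕ} {ζ : Circle} {d : ℤ} {deg : Fin n → ℤ} {Ω : Matrix (Fin n) (Fin n) ℂ}

/-- The unitarity relations are conjugated by a diagonal unitary. In the invariance relation `deg i
+ deg k = d` on the support of `Ω` makes the twist constant along each sum, and both sides scale by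
the same factor `z ^ (d - d_i - d_j)`. -/
theorem BraidedOrthogonalRelations.twist (hΩ : ∀ i j, Ω i j ≠ 0 → deg i + deg j = d)
    {A : Type*} [Ring A] [StarRing A] [Algebra ℂ A] [StarModule ℂ A] {u : Fin n → Fin n → A}
    (hu : BraidedOrthogonalRelations ζ d deg Ω u) (z : Circle) :
    BraidedOrthogonalRelations ζ d deg Ω fun i j => (z : ℂ) ^ (deg j - deg i) • u i j where
  isometry i j := by
    have hz : (z : ℂ) ≠ 0 := Circle.coe_ne_zero z
    have h (k : Fin n) : star ((z : ℂ) ^ (deg i - deg k) • u k i) * ((z : ℂ) ^ (deg j - deg k) •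
        u k j) = (z : ℂ) ^ (deg j - deg i) • (star (u k i) * u k j) := by
      rw [star_smul, Circle.star_coe_zpow, smul_mul_smul_comm, ← zpow_add₀ hz]
      congr 2; ring
    simp only [h, ← Finset.smul_sum, hu.isometry]
    split_ifs with hij
    · subst hij; simp
    · simp
  coisometry i j := by
    have hz : (z : ℂ) ≠ 0 := Circle.coe_ne_zero z
    have h (k : Fin n) : ((z : ℂ) ^ (deg k - deg i) • u i k) * star ((z : ℂ) ^ (deg k - deg j) •
        u j k) = (z : ℂ) ^ (deg j - deg i) • (u i k * star (u j k)) := by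
      rw [star_smul, Circle.star_coe_zpow, smul_mul_smul_comm, ← zpow_add₀ hz]
      congr 2; ring
    simp only [h, ← Finset.smul_sum, hu.coisometry]
    split_ifs with hij
    · subst hij; simp
    · simp
  invariant i j := by
    have h1 (k : Fin n) : Ω i k • (z : ℂ) ^ (deg k - deg j) • u j k =
        (z : ℂ) ^ (d - deg i - deg j) • Ω i k • u j k := by
      rcases eq_or_ne (Ω i k) 0 with h | h
      · simp [h]
      · rw [smul_comm, ← hΩ i k h]
        congr 2; ring
    have h2 (k : Fin n) : Ω k j • star ((z : ℂ) ^ (deg i - deg k) • u k i) =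
        (z : ℂ) ^ (d - deg i - deg j) • Ω k j • star (u k i) := by
      rcases eq_or_ne (Ω k j) 0 with h | h
      · simp [h]
      · rw [star_smul, Circle.star_coe_zpow, smul_comm, ← hΩ k j h]
        congr 2; ring
    simp only [h1, h2, ← Finset.smul_sum]
    rw [smul_comm, hu.invariant, smul_comm]

/-- The braided product of two matrices that satisfy the defining relations and whose entries
commute up to the braiding phases satisfies the defining relations. -/
theorem BraidedOrthogonalRelations.braidedMul (hΩ : ∀ i j, Ω i j ≠ 0 → deg i + deg j = d)
    {A : Type*} [Ring A] [StarRing A] [Algebra ℂ A] {u v : Fin n → Fin n → A}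
    (hu : BraidedOrthogonalRelations ζ d deg Ω u) (hv : BraidedOrthogonalRelations ζ d deg Ω v)
    (huv : ∀ i j k l, star (v k l) * star (u i j) =
      (ζ : ℂ) ^ ((deg i - deg j) * (deg k - deg l)) • (star (u i j) * star (v k l))) :
    BraidedOrthogonalRelations ζ d deg Ω fun i k => ∑ l, u i l * v l k where
  isometry i j := by
    -- The sum over `k` meets only entries of `u`, which stand next to each other, so no commutation
    -- is needed; in the coisometry relation the same happens with `v`.
    calc ∑ k, star (∑ l, u k l * v l i) * ∑ m, u k m * v m j
        = ∑ l, ∑ m, star (v l i) * (∑ k, star (u k l) * u k m) * v m j := by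
          simp only [star_sum, star_mul, Finset.sum_mul, Finset.mul_sum]
          rw [Finset.sum_comm]
          refine (Finset.sum_congr rfl fun m _ => Finset.sum_comm).trans ?_
          rw [Finset.sum_comm]
          simp only [mul_assoc]
      _ = _ := by
          simp only [hu.isometry, mul_ite, mul_one, mul_zero, ite_mul, zero_mul,
            Finset.sum_ite_eq, Finset.mem_univ, if_true, hv.isometry]
  coisometry i j := by
    calc ∑ k, (∑ l, u i l * v l k) * star (∑ m, u j m * v m k)
        = ∑ l, ∑ m, u i l * (∑ k, v l k * star (v m k)) * star (u j m) := by
          simp only [star_sum, star_mul, Finset.sum_mul, Finset.mul_sum]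
          rw [Finset.sum_comm]
          refine (Finset.sum_congr rfl fun m _ => Finset.sum_comm).trans ?_
          rw [Finset.sum_comm]
          simp only [mul_assoc]
      _ = _ := by
          simp only [hv.coisometry, mul_ite, mul_one, mul_zero, ite_mul, zero_mul,
            Finset.sum_ite_eq, Finset.mem_univ, if_true, hu.coisometry]
  invariant i j := by
    have hζ : (ζ : ℂ) ≠ 0 := Circle.coe_ne_zero ζ
    -- This and `hu'` are the invariance relations of `v` and `u`, each with its phase moved to one
    -- side. Both sides of the new relation are thereby reduced to combinations of `u_jk v_li*`.
    have hv' (l : Fin n) : ∑ k, Ω i k • v l k =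
        (ζ : ℂ) ^ (deg l * (d - deg l) - deg l * deg i) • ∑ k, Ω k l • star (v k i) := by
      have h := congrArg (fun x => (ζ : ℂ) ^ (-(deg l * deg i)) • x) (hv.invariant i l)
      simp only [smul_smul, ← zpow_add₀ hζ, neg_add_cancel, zpow_zero, one_smul] at h
      rw [h, neg_add_eq_sub]
    have hu' (l : Fin n) : ∑ k, Ω k j • star (u k l) =
        (ζ : ℂ) ^ (deg j * deg l - deg j * (d - deg j)) • ∑ k, Ω l k • u j k := by
      have h := congrArg (fun x => (ζ : ℂ) ^ (-(deg j * (d - deg j))) • x) (hu.invariant l j)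
      simp only [smul_smul, ← zpow_add₀ hζ, neg_add_cancel, zpow_zero, one_smul] at h
      rw [← h, neg_add_eq_sub]
    have hL : ∑ k, Ω i k • ∑ l, u j l * v l k = ∑ l, ∑ k,
        ((ζ : ℂ) ^ (deg l * (d - deg l) - deg l * deg i) * Ω k l) • (u j l * star (v k i)) := by
      calc _ = ∑ l, u j l * ∑ k, Ω i k • v l k := by
            simp only [Finset.smul_sum, Finset.mul_sum, mul_smul_comm]
            rw [Finset.sum_comm]
        _ = _ := by
            simp only [hv', Finset.smul_sum, Finset.mul_sum, mul_smul_comm, smul_smul]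
    have hR : ∑ k, Ω k j • star (∑ l, u k l * v l i) = ∑ l, ∑ k,
        ((ζ : ℂ) ^ ((d - deg j - deg l) * (deg l - deg i) +
          (deg j * deg l - deg j * (d - deg j))) * Ω l k) • (u j k * star (v l i)) := by
      -- The braiding phase depends on `deg k`, but the factor `Ω k j` allows `deg k` to be replaced
      -- by `d - deg j`. The phase then leaves the sum over `k`, so that `hu'` applies.
      have h1 (k l : Fin n) : Ω k j • (star (v l i) * star (u k l)) =
          (ζ : ℂ) ^ ((d - deg j - deg l) * (deg l - deg i)) •
            ((Ω k j • star (u k l)) * star (v l i)) := by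
        rcases eq_or_ne (Ω k j) 0 with h | h
        · simp [h]
        · rw [huv, smul_comm, ← hΩ k j h, smul_mul_assoc]
          congr 3; ring
      calc _ = ∑ l, (ζ : ℂ) ^ ((d - deg j - deg l) * (deg l - deg i)) •
              ((∑ k, Ω k j • star (u k l)) * star (v l i)) := by
            simp only [star_sum, star_mul, Finset.smul_sum, Finset.sum_mul, h1]
            rw [Finset.sum_comm]
        _ = _ := by
            simp only [hu', Finset.smul_sum, Finset.sum_mul, smul_mul_assoc, smul_smul,
              zpow_add₀ hζ, mul_assoc]
    rw [hL, hR, Finset.sum_comm]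
    simp only [Finset.smul_sum, smul_smul, ← mul_assoc, ← zpow_add₀ hζ]
    -- With `d = deg l + deg k` on the support of `Ω l k`, both exponents of `ζ` become `d_k d_l -
    -- d_k d_i + d_j d_i`.
    refine Finset.sum_congr rfl fun l _ => Finset.sum_congr rfl fun k _ => ?_
    rcases eq_or_ne (Ω l k) 0 with h | h
    · simp [h]
    · rw [← hΩ l k h]
      congr 3; ring

/-! ### The action and the comultiplication on `A_o` -/

namespace Ao

variable (ζ)

/-- The relations in `C(𝕋, A_o)` are checked pointwise, where they are the twisted ones. Working in
this algebra from the outset makes every orbit continuous. -/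
theorem relations_orbit (hΩ : ∀ i j, Ω i j ≠ 0 → deg i + deg j = d) :
    BraidedOrthogonalRelations ζ d deg Ω fun i j =>
      (⟨fun z : Circle => (z : ℂ) ^ (deg j - deg i) • u ζ d deg Ω i j, by
        simp only [← Circle.coe_zpow]
        have h : Continuous fun z : Circle => ((z ^ (deg j - deg i) : Circle) : ℂ) :=
          continuous_subtype_val.comp (continuous_zpow (G := Circle) (deg j - deg i))
        exact h.smul continuous_const⟩ : C(Circle, Ao ζ d deg Ω)) where
  isometry i j := by
    ext z
    have := ((relations ζ d deg Ω).twist hΩ z).isometry i j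
    split_ifs at this ⊢ <;> simpa [ContinuousMap.sum_apply] using this
  coisometry i j := by
    ext z
    have := ((relations ζ d deg Ω).twist hΩ z).coisometry i j
    split_ifs at this ⊢ <;> simpa [ContinuousMap.sum_apply] using this
  invariant i j := by
    ext z
    have := ((relations ζ d deg Ω).twist hΩ z).invariant i j
    simpa [ContinuousMap.sum_apply] using this

/-- The circle action on `A_o` with `β_z(u_ij) = z ^ (d_j - d_i) u_ij`. -/
def action (hΩ : ∀ i j, Ω i j ≠ 0 → deg i + deg j = d) : CircleAction (Ao ζ d deg Ω) where
  hom := lift _ (relations_orbit ζ hΩ)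
  hom_one b := by
    have h : (evalCircle (B := Ao ζ d deg Ω) (1 : Circle)).comp
        (lift _ (relations_orbit ζ hΩ)) = StarAlgHom.id ℂ (Ao ζ d deg Ω) :=
      hom_ext fun i j => by simp [lift_u, evalCircle_apply]
    exact DFunLike.congr_fun h b
  hom_mul z w b := by
    -- Both sides are *-homomorphisms `A_o → A_o`, so the group law reduces to multiplicativity of
    -- `z ↦ z ^ (d_j - d_i)` on the generators.
    have h : (evalCircle (B := Ao ζ d deg Ω) (z * w)).comp
        (lift _ (relations_orbit ζ hΩ)) =
        ((evalCircle (B := Ao ζ d deg Ω) z).comp (lift _ (relations_orbit ζ hΩ))).comp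
        ((evalCircle (B := Ao ζ d deg Ω) w).comp (lift _ (relations_orbit ζ hΩ))) :=
      hom_ext fun i j => by
        simp [lift_u, evalCircle_apply, smul_smul, mul_zpow, mul_comm]
    exact DFunLike.congr_fun h b

theorem action_hom_u (hΩ : ∀ i j, Ω i j ≠ 0 → deg i + deg j = d) (z : Circle) (i j : Fin n) :
    (action ζ hΩ).hom (u ζ d deg Ω i j) z = (z : ℂ) ^ (deg j - deg i) • u ζ d deg Ω i j :=
  congrArg (fun f : C(Circle, Ao ζ d deg Ω) => f z) (lift_u _ (relations_orbit ζ hΩ) i j)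

theorem isHomogeneous_u (hΩ : ∀ i j, Ω i j ≠ 0 → deg i + deg j = d) (i j : Fin n) :
    (action ζ hΩ).IsHomogeneous (deg j - deg i) (u ζ d deg Ω i j) := fun z => by
  rw [CircleAction.act_apply, action_hom_u, Circle.coe_zpow]

-- The images of `u` under `j₁` and `j₂` satisfy the relations, and the adjoints of their entries
-- are homogeneous, so the commutation rule supplies the phases required by `braidedMul`.
open BraidedTensor in
theorem relations_comul (hΩ : ∀ i j, Ω i j ≠ 0 → deg i + deg j = d) :
    BraidedOrthogonalRelations ζ d deg Ω fun i k => ∑ l,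
      j₁ ζ (action ζ hΩ) (action ζ hΩ) (u ζ d deg Ω i l) *
        j₂ ζ (action ζ hΩ) (action ζ hΩ) (u ζ d deg Ω l k) := by
  refine ((relations ζ d deg Ω).map (j₁ ζ (action ζ hΩ) (action ζ hΩ))).braidedMul hΩ
    ((relations ζ d deg Ω).map (j₂ ζ (action ζ hΩ) (action ζ hΩ))) fun i j k l => ?_
  rw [← StarHomClass.map_star, ← StarHomClass.map_star,
    j₂_mul_j₁ (isHomogeneous_u ζ hΩ i j).star (isHomogeneous_u ζ hΩ k l).star, Circle.coe_zpow]
  congr 2; ring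

/-- The comultiplication of `A_o`. -/
def comul (hΩ : ∀ i j, Ω i j ≠ 0 → deg i + deg j = d) :
    Ao ζ d deg Ω →⋆ₐ[ℂ] BraidedTensor ζ (action ζ hΩ) (action ζ hΩ) :=
  lift _ (relations_comul ζ hΩ)

theorem comul_u (hΩ : ∀ i j, Ω i j ≠ 0 → deg i + deg j = d) (i k : Fin n) :
    comul ζ hΩ (u ζ d deg Ω i k) = ∑ l,
      BraidedTensor.j₁ ζ (action ζ hΩ) (action ζ hΩ) (u ζ d deg Ω i l) *
        BraidedTensor.j₂ ζ (action ζ hΩ) (action ζ hΩ) (u ζ d deg Ω l k) :=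
  lift_u _ (relations_comul ζ hΩ) i k

/-- On generators the degrees `d_l - d_i` and `d_k - d_l` of the two factors add up to `d_k - d_i`,
independently of `l`. -/
theorem comul_equivariant (hΩ : ∀ i j, Ω i j ≠ 0 → deg i + deg j = d) :
    IsEquivariant (action ζ hΩ) (BraidedTensor.action ζ (action ζ hΩ) (action ζ hΩ))
      (comul ζ hΩ) := fun z x => by
  have h : (comul ζ hΩ).comp ((action ζ hΩ).act z) =
      ((BraidedTensor.action ζ (action ζ hΩ) (action ζ hΩ)).act z).comp (comul ζ hΩ) := by
    refine hom_ext fun i k => ?_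
    rw [StarAlgHom.comp_apply, StarAlgHom.comp_apply, isHomogeneous_u, map_smul, comul_u,
      map_sum, Finset.smul_sum]
    refine Finset.sum_congr rfl fun l _ => ?_
    rw [BraidedTensor.action_act, map_mul, BraidedTensor.diagAct, BraidedTensor.map_j₁,
      BraidedTensor.map_j₂, isHomogeneous_u, isHomogeneous_u, map_smul, map_smul,
      smul_mul_smul_comm, ← Circle.coe_mul, ← zpow_add]
    congr 3; ring
  exact DFunLike.congr_fun h x

/-- Both sides are *-homomorphisms in `b`, and both send `u_ik` to `∑ l m, j₁(u_il) j₂(u_lm)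
j₃(u_mk)`, as for matrix multiplication. -/
theorem comul_coassoc (hΩ : ∀ i j, Ω i j ≠ 0 → deg i + deg j = d) (b : Ao ζ d deg Ω) :
    BraidedTriple.ofLeft ζ (BraidedTensor.map (comul ζ hΩ) (comul_equivariant ζ hΩ)
      (StarAlgHom.id ℂ _) (IsEquivariant.id (action ζ hΩ)) (comul ζ hΩ b)) =
    BraidedTriple.ofRight ζ (BraidedTensor.map (StarAlgHom.id ℂ _) (IsEquivariant.id (action ζ hΩ))
      (comul ζ hΩ) (comul_equivariant ζ hΩ) (comul ζ hΩ b)) := by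
  have h : ((BraidedTriple.ofLeft ζ).comp (BraidedTensor.map (comul ζ hΩ) (comul_equivariant ζ hΩ)
      (StarAlgHom.id ℂ _) (IsEquivariant.id (action ζ hΩ)))).comp (comul ζ hΩ) =
    ((BraidedTriple.ofRight ζ).comp (BraidedTensor.map (StarAlgHom.id ℂ _)
      (IsEquivariant.id (action ζ hΩ)) (comul ζ hΩ) (comul_equivariant ζ hΩ))).comp (comul ζ hΩ) := by
    refine hom_ext fun i k => ?_
    have hl (x y) : BraidedTriple.ofLeft ζ (BraidedTensor.map (comul ζ hΩ) (comul_equivariant ζ hΩ)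
        (StarAlgHom.id ℂ _) (IsEquivariant.id (action ζ hΩ))
        (BraidedTensor.j₁ ζ (action ζ hΩ) (action ζ hΩ) x * BraidedTensor.j₂ ζ _ _ y)) =
        BraidedTriple.j₁₂ ζ (comul ζ hΩ x) * BraidedTriple.j₃ ζ _ _ _ y := by
      rw [map_mul, map_mul, BraidedTensor.map_j₁, BraidedTensor.map_j₂, BraidedTriple.ofLeft,
        BraidedTensor.lift_j₁, BraidedTensor.lift_j₂]
      rfl
    have hr (x y) : BraidedTriple.ofRight ζ (BraidedTensor.map (StarAlgHom.id ℂ _)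
        (IsEquivariant.id (action ζ hΩ)) (comul ζ hΩ) (comul_equivariant ζ hΩ)
        (BraidedTensor.j₁ ζ (action ζ hΩ) (action ζ hΩ) x * BraidedTensor.j₂ ζ _ _ y)) =
        BraidedTriple.j₁ ζ _ _ _ x * BraidedTriple.j₂₃ ζ (comul ζ hΩ y) := by
      rw [map_mul, map_mul, BraidedTensor.map_j₁, BraidedTensor.map_j₂, BraidedTriple.ofRight,
        BraidedTensor.lift_j₁, BraidedTensor.lift_j₂]
      rfl
    have h12 (i k) : BraidedTriple.j₁₂ ζ (δ := action ζ hΩ) (comul ζ hΩ (u ζ d deg Ω i k)) =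
        ∑ l, BraidedTriple.j₁ ζ _ _ _ (u ζ d deg Ω i l) *
          BraidedTriple.j₂ ζ _ _ _ (u ζ d deg Ω l k) := by
      simp only [comul_u, map_sum, map_mul, BraidedTriple.j₁₂, BraidedTensor.lift_j₁,
        BraidedTensor.lift_j₂]
    have h23 (i k) : BraidedTriple.j₂₃ ζ (β := action ζ hΩ) (comul ζ hΩ (u ζ d deg Ω i k)) =
        ∑ l, BraidedTriple.j₂ ζ _ _ _ (u ζ d deg Ω i l) *
          BraidedTriple.j₃ ζ _ _ _ (u ζ d deg Ω l k) := by
      simp only [comul_u, map_sum, map_mul, BraidedTriple.j₂₃, BraidedTensor.lift_j₁,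
        BraidedTensor.lift_j₂]
    simp only [StarAlgHom.comp_apply]
    rw [comul_u, map_sum, map_sum, map_sum, map_sum]
    simp only [hl, hr, h12, h23, Finset.sum_mul, Finset.mul_sum, mul_assoc]
    rw [Finset.sum_comm]
  exact DFunLike.congr_fun h b

end Ao

end Relations

end

noncomputable section

/-! ### The Podleś conditions -/

/-- Applied below to the pairs `(j₁, j₂)`, `(Δ, j₂)` and `(j₁, Δ)`: the outer factors are absorbed
without any commutation. -/
theorem mul_mul_mem_span_range {B C D : Type*} [Ring B] [Ring C] [Ring D] [Algebra ℂ B]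
    [Algebra ℂ C] [Algebra ℂ D] [Star B] [Star C] [Star D] (f : B →⋆ₐ[ℂ] D) (g : C →⋆ₐ[ℂ] D)
    {v : D} (hv : v ∈ Submodule.span ℂ (Set.range fun x : B × C => f x.1 * g x.2)) (b : B)
    (c : C) : f b * v * g c ∈ Submodule.span ℂ (Set.range fun x : B × C => f x.1 * g x.2) := by
  induction hv using Submodule.span_induction with
  | mem v h =>
    obtain ⟨x, rfl⟩ := h
    refine Submodule.subset_span ⟨(b * x.1, x.2 * c), ?_⟩
    simp only [map_mul, mul_assoc]
  | zero => simp
  | add v w _ _ hv hw => rw [mul_add, add_mul]; exact add_mem hv hw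
  | smul r v _ hv => rw [mul_smul_comm, smul_mul_assoc]; exact Submodule.smul_mem _ r hv

/-- The products `j₁(x) j₂(y)` span a dense subspace as soon as the products `j₂(y) j₁(x)` belong
to their closed linear span. -/
theorem BraidedTensor.closure_span_j₁_mul_j₂ {X Y : Type} [CStarAlgebra X] [CStarAlgebra Y]
    {ζ : Circle} {β : CircleAction X} {γ : CircleAction Y}
    (h : ∀ x y, j₂ ζ β γ y * j₁ ζ β γ x ∈ (Submodule.span ℂ (Set.range fun x : X × Y =>
      j₁ ζ β γ x.1 * j₂ ζ β γ x.2)).topologicalClosure) :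
    (Submodule.span ℂ (Set.range fun x : X × Y =>
      j₁ ζ β γ x.1 * j₂ ζ β γ x.2)).topologicalClosure = ⊤ := by
  set W := Submodule.span ℂ (Set.range fun x : X × Y => j₁ ζ β γ x.1 * j₂ ζ β γ x.2)
  have hmul (s t : BraidedTensor ζ β γ)
      (hst : ∀ v ∈ W, s * v * t ∈ W.topologicalClosure) (v) (hv : v ∈ W.topologicalClosure) :
      s * v * t ∈ W.topologicalClosure := by
    have hc : IsClosed {v | s * v * t ∈ W.topologicalClosure} :=
      W.isClosed_topologicalClosure.preimage (by fun_prop)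
    exact closure_minimal (s := (W : Set (BraidedTensor ζ β γ))) hst hc hv
  have h₁ (x : X) (v) (hv : v ∈ W.topologicalClosure) :
      j₁ ζ β γ x * v ∈ W.topologicalClosure := by
    have := hmul (j₁ ζ β γ x) 1 (fun v hv => W.le_topologicalClosure (by
      simpa using mul_mul_mem_span_range (j₁ ζ β γ) (j₂ ζ β γ) hv x 1)) v hv
    rwa [mul_one] at this
  -- In `j₂(y) j₁(x) j₂(y')` the first two factors lie in the closure of `W` by `h`, and that
  -- closure is stable under right multiplication by `j₂(y')`.
  have h₂ (y : Y) (v) (hv : v ∈ W.topologicalClosure) :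
      j₂ ζ β γ y * v ∈ W.topologicalClosure := by
    have := hmul (j₂ ζ β γ y) 1 (fun v hv => by
      rw [mul_one]
      induction hv using Submodule.span_induction with
      | mem v hv =>
        obtain ⟨x, rfl⟩ := hv
        have h3 := hmul 1 (j₂ ζ β γ x.2) (fun v hv => W.le_topologicalClosure (by
          simpa using mul_mul_mem_span_range (j₁ ζ β γ) (j₂ ζ β γ) hv 1 x.2)) _ (h x.1 y)
        simpa only [one_mul, mul_assoc] using h3
      | zero => simp
      | add v w _ _ hv hw => rw [mul_add]; exact add_mem hv hw
      | smul r v _ hv => rw [mul_smul_comm]; exact Submodule.smul_mem _ r hv) v hv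
    rwa [mul_one] at this
  -- The closure of `W` is a left module over the dense image of the free *-algebra. As it contains
  -- `1`, it contains that image.
  have hincl (w : FreeStarAlgebra (X ⊕ Y)) (v) (hv : v ∈ W.topologicalClosure) :
      incl ζ β γ w * v ∈ W.topologicalClosure := by
    induction w using FreeStarAlgebra.induction generalizing v with
    | h0 c =>
      rw [AlgHomClass.commutes, Algebra.algebraMap_eq_smul_one, smul_mul_assoc, one_mul]
      exact Submodule.smul_mem _ c hv
    | h1 x =>
      cases x with
      | inl x => exact h₁ x v hv
      | inr y => exact h₂ y v hv
    | h1' x =>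
      rw [StarHomClass.map_star]
      cases x with
      | inl x => rw [incl_inl, ← StarHomClass.map_star]; exact h₁ (star x) v hv
      | inr y => rw [incl_inr, ← StarHomClass.map_star]; exact h₂ (star y) v hv
    | h2 a b ha hb => rw [map_mul, mul_assoc]; exact ha _ (hb v hv)
    | h3 a b ha hb => rw [map_add, add_mul]; exact add_mem (ha v hv) (hb v hv)
  have hone : (1 : BraidedTensor ζ β γ) ∈ W.topologicalClosure :=
    W.le_topologicalClosure (Submodule.subset_span ⟨(1, 1), by simp⟩)
  have hdense : Dense (W.topologicalClosure : Set (BraidedTensor ζ β γ)) := by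
    refine (dense_incl ζ β γ).mono ?_
    rintro _ ⟨w, rfl⟩
    have := hincl w 1 hone
    rwa [mul_one] at this
  rw [eq_top_iff]
  intro v _
  exact W.isClosed_topologicalClosure.closure_subset (hdense v)

/-! ### Density of products in `A_o ⊠ A_o` -/

namespace Ao

variable {n : ℕ} (ζ : Circle) {d : ℤ} {deg : Fin n → ℤ} {Ω : Matrix (Fin n) (Fin n) ℂ}

/-- A closed linear condition need only be tested on words. This confines the density arguments to
homogeneous elements, for which the commutation rule is available. -/
theorem apply_mem_of_words {E : Type*} [AddCommGroup E] [Module ℂ E] [TopologicalSpace E]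
    (hdet : IsUnit Ω.det) (f : Ao ζ d deg Ω →ₗ[ℂ] E) (hf : Continuous f) (W : Submodule ℂ E)
    (hW : IsClosed (W : Set E)) (h : ∀ x ∈ words ζ d deg Ω, f x ∈ W) (a : Ao ζ d deg Ω) :
    f a ∈ W := by
  have h1 : (Submodule.span ℂ (words ζ d deg Ω : Set (Ao ζ d deg Ω))).topologicalClosure ≤
      W.comap f :=
    Submodule.topologicalClosure_minimal _ (Submodule.span_le.mpr h) (hW.preimage hf)
  rw [closure_span_words hdet] at h1
  exact h1 trivial

theorem exists_isHomogeneous_of_mem_words (hΩ : ∀ i j, Ω i j ≠ 0 → deg i + deg j = d)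
    {x : Ao ζ d deg Ω} (hx : x ∈ words ζ d deg Ω) : ∃ k, (action ζ hΩ).IsHomogeneous k x := by
  induction hx using Submonoid.closure_induction with
  | mem x h =>
    obtain ⟨⟨i, j⟩, rfl⟩ := h
    exact ⟨_, isHomogeneous_u ζ hΩ i j⟩
  | one => exact ⟨0, .one⟩
  | mul x y _ _ hx hy =>
    obtain ⟨k, hk⟩ := hx
    obtain ⟨l, hl⟩ := hy
    exact ⟨_, hk.mul hl⟩

variable (hΩ : ∀ i j, Ω i j ≠ 0 → deg i + deg j = d)

local notation "J₁" => BraidedTensor.j₁ ζ (action ζ hΩ) (action ζ hΩ)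
local notation "J₂" => BraidedTensor.j₂ ζ (action ζ hΩ) (action ζ hΩ)

/-- For words `x` and `y` the product `j₂(y) j₁(x)` is a phase times `j₁(x) j₂(y)`. Density and
continuity, in one variable at a time, extend membership in the closed span to all `x` and `y`. -/
theorem closure_span_j₁_mul_j₂ (hdet : IsUnit Ω.det) :
    (Submodule.span ℂ (Set.range fun x : Ao ζ d deg Ω × Ao ζ d deg Ω =>
      J₁ x.1 * J₂ x.2)).topologicalClosure = ⊤ := by
  refine BraidedTensor.closure_span_j₁_mul_j₂ fun x y => ?_
  refine apply_mem_of_words ζ hdet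
    ((LinearMap.mulLeft ℂ (J₂ y)).comp ((J₁).toAlgHom.toLinearMap))
    (continuous_const.mul (continuous_starAlgHom (J₁))) _
    (Submodule.isClosed_topologicalClosure _) (fun x hx => ?_) x
  refine apply_mem_of_words ζ hdet
    ((LinearMap.mulRight ℂ (J₁ x)).comp ((J₂).toAlgHom.toLinearMap))
    ((continuous_starAlgHom (J₂)).mul continuous_const) _
    (Submodule.isClosed_topologicalClosure _) (fun y hy => ?_) y
  obtain ⟨k, hk⟩ := exists_isHomogeneous_of_mem_words ζ hΩ hx
  obtain ⟨l, hl⟩ := exists_isHomogeneous_of_mem_words ζ hΩ hy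
  change J₂ y * J₁ x ∈ _
  rw [BraidedTensor.j₂_mul_j₁ hk hl]
  exact Submodule.smul_mem _ _ (Submodule.le_topologicalClosure _
    (Submodule.subset_span ⟨(x, y), rfl⟩))

/-- Coisometry of `u` cancels the second tensor factor of `Δ(u_ik)`. This stands in for an antipode
in the first Podleś condition. -/
theorem sum_comul_mul_j₂_star (i m : Fin n) :
    ∑ k, comul ζ hΩ (u ζ d deg Ω i k) * J₂ (star (u ζ d deg Ω m k)) = J₁ (u ζ d deg Ω i m) := by
  calc _ = ∑ l, J₁ (u ζ d deg Ω i l) * J₂ (∑ k, u ζ d deg Ω l k * star (u ζ d deg Ω m k)) := by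
        simp only [comul_u, Finset.sum_mul, map_sum, map_mul, Finset.mul_sum, mul_assoc]
        rw [Finset.sum_comm]
    _ = _ := by
        simp only [(relations ζ d deg Ω).coisometry, apply_ite (J₂), map_one, map_zero, mul_ite,
          mul_one, mul_zero, Finset.sum_ite_eq', Finset.mem_univ, if_true]

/-- The mirror image: isometry of `u` cancels the first tensor factor. -/
theorem sum_j₁_star_mul_comul (m k : Fin n) :
    ∑ i, J₁ (star (u ζ d deg Ω i m)) * comul ζ hΩ (u ζ d deg Ω i k) = J₂ (u ζ d deg Ω m k) := by
  calc _ = ∑ l, J₁ (∑ i, star (u ζ d deg Ω i m) * u ζ d deg Ω i l) * J₂ (u ζ d deg Ω l k) := by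
        simp only [comul_u, Finset.sum_mul, map_sum, map_mul, Finset.mul_sum, mul_assoc]
        rw [Finset.sum_comm]
    _ = _ := by
        simp only [(relations ζ d deg Ω).isometry, apply_ite (J₁), map_one, map_zero, ite_mul,
          one_mul, zero_mul, Finset.sum_ite_eq, Finset.mem_univ, if_true]

/-- Letters are added on the left: `j₁(u_im x) = ∑ l, Δ(u_il) j₂(u_ml*) j₁(x)`. The word `x` is
homogeneous, so `j₂(u_ml*)` moves to the right of `j₁(x)` at the cost of a phase, and the span
absorbs the outer factors `Δ(u_il)` and `j₂(u_ml*)`. -/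
theorem j₁_mem_span_of_mem_words {x : Ao ζ d deg Ω} (hx : x ∈ words ζ d deg Ω) :
    J₁ x ∈ Submodule.span ℂ (Set.range fun x : Ao ζ d deg Ω × Ao ζ d deg Ω =>
      comul ζ hΩ x.1 * J₂ x.2) := by
  induction hx using Submonoid.closure_induction_left with
  | one => exact Submodule.subset_span ⟨(1, 1), by simp⟩
  | mul_left y hy x hx ih =>
    obtain ⟨⟨i, m⟩, rfl⟩ := hy
    obtain ⟨k, hk⟩ := exists_isHomogeneous_of_mem_words ζ hΩ hx
    rw [map_mul, ← sum_comul_mul_j₂_star, Finset.sum_mul]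
    refine Submodule.sum_mem _ fun l _ => ?_
    rw [mul_assoc, BraidedTensor.j₂_mul_j₁ hk (isHomogeneous_u ζ hΩ m l).star, mul_smul_comm,
      ← mul_assoc]
    exact Submodule.smul_mem _ _ (mul_mul_mem_span_range _ _ ih _ _)

/-- Here letters are added on the right: `j₂(y u_mk) = ∑ i, j₂(y) j₁(u_im*) Δ(u_ik)`, and
`j₁(u_im*)` moves to the left of `j₂(y)`. -/
theorem j₂_mem_span_of_mem_words {y : Ao ζ d deg Ω} (hy : y ∈ words ζ d deg Ω) :
    J₂ y ∈ Submodule.span ℂ (Set.range fun x : Ao ζ d deg Ω × Ao ζ d deg Ω =>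
      J₁ x.1 * comul ζ hΩ x.2) := by
  induction hy using Submonoid.closure_induction_right with
  | one => exact Submodule.subset_span ⟨(1, 1), by simp⟩
  | mul_right y hy x hx ih =>
    obtain ⟨⟨m, k⟩, rfl⟩ := hx
    obtain ⟨l, hl⟩ := exists_isHomogeneous_of_mem_words ζ hΩ hy
    rw [map_mul, ← sum_j₁_star_mul_comul, Finset.mul_sum]
    refine Submodule.sum_mem _ fun i _ => ?_
    rw [← mul_assoc, BraidedTensor.j₂_mul_j₁ (isHomogeneous_u ζ hΩ i m).star hl, smul_mul_assoc]
    exact Submodule.smul_mem _ _ (mul_mul_mem_span_range _ _ ih _ _)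

/-- It suffices to reach the dense products `j₁(a) j₂(b)`. Only `a` has to be approximated by words,
since the span is stable under right multiplication by `j₂(b)` for every `b`. -/
theorem comul_podles_right (hdet : IsUnit Ω.det) :
    (Submodule.span ℂ (Set.range fun x : Ao ζ d deg Ω × Ao ζ d deg Ω =>
      comul ζ hΩ x.1 * J₂ x.2)).topologicalClosure = ⊤ := by
  rw [eq_top_iff, ← closure_span_j₁_mul_j₂ ζ hΩ hdet]
  refine Submodule.topologicalClosure_minimal _ (Submodule.span_le.mpr ?_)
    (Submodule.isClosed_topologicalClosure _)
  rintro _ ⟨⟨a, b⟩, rfl⟩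
  refine apply_mem_of_words ζ hdet
    ((LinearMap.mulRight ℂ (J₂ b)).comp ((J₁).toAlgHom.toLinearMap))
    ((continuous_starAlgHom (J₁)).mul continuous_const) _
    (Submodule.isClosed_topologicalClosure _) (fun x hx => ?_) a
  refine Submodule.le_topologicalClosure _ ?_
  simpa using mul_mul_mem_span_range (comul ζ hΩ) (J₂) (j₁_mem_span_of_mem_words ζ hΩ hx) 1 b

theorem comul_podles_left (hdet : IsUnit Ω.det) :
    (Submodule.span ℂ (Set.range fun x : Ao ζ d deg Ω × Ao ζ d deg Ω =>
      J₁ x.1 * comul ζ hΩ x.2)).topologicalClosure = ⊤ := by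
  rw [eq_top_iff, ← closure_span_j₁_mul_j₂ ζ hΩ hdet]
  refine Submodule.topologicalClosure_minimal _ (Submodule.span_le.mpr ?_)
    (Submodule.isClosed_topologicalClosure _)
  rintro _ ⟨⟨a, b⟩, rfl⟩
  refine apply_mem_of_words ζ hdet
    ((LinearMap.mulLeft ℂ (J₁ a)).comp ((J₂).toAlgHom.toLinearMap))
    (continuous_const.mul (continuous_starAlgHom (J₂))) _
    (Submodule.isClosed_topologicalClosure _) (fun y hy => ?_) b
  refine Submodule.le_topologicalClosure _ ?_
  simpa using mul_mul_mem_span_range (J₁) (comul ζ hΩ) (j₂_mem_span_of_mem_words ζ hΩ hy) a 1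

/-- `A_o` is a braided compact quantum group. -/
theorem isBraidedCompactQuantumGroup (hdet : IsUnit Ω.det) :
    IsBraidedCompactQuantumGroup ζ (action ζ hΩ) (comul ζ hΩ) where
  equivariant := comul_equivariant ζ hΩ
  coassoc := comul_coassoc ζ hΩ
  podles_right := comul_podles_right ζ hΩ hdet
  podles_left := comul_podles_left ζ hΩ hdet

end Ao

end

/-! ### The coefficient matrix of a homogeneous vector -/

section Coefficients

variable {n : ℕ} {V : Type*} [AddCommGroup V] [Module ℂ V] (e : Module.Basis (Fin n) ℂ V)
  (π : Circle →* (V →ₗ[ℂ] V)) (deg : Fin n → ℤ)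

theorem Circle.eq_of_forall_zpow_eq {k l : ℤ} (h : ∀ z : Circle, (z : ℂ) ^ k = (z : ℂ) ^ l) :
    k = l := by
  by_contra hne
  have hm : ((k - l : ℤ) : ℂ) ≠ 0 := Int.cast_ne_zero.mpr (sub_ne_zero.mpr hne)
  -- The point `exp(iπ / (k - l))` has `(k - l)`-th power `-1`, so it separates the two characters.
  have h1 : (Circle.exp (Real.pi / ((k - l : ℤ) : ℝ)) : ℂ) ^ (k - l) = 1 := by
    rw [zpow_sub₀ (Circle.coe_ne_zero _), h, div_self (zpow_ne_zero _ (Circle.coe_ne_zero _))]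
  rw [Circle.coe_exp, ← Complex.exp_int_mul, Complex.ofReal_div, Complex.ofReal_intCast,
    ← mul_assoc, mul_div_cancel₀ _ hm, Complex.exp_pi_mul_I] at h1
  norm_num at h1

theorem coeffMatrix_map (hπ : ∀ z i, π z (e i) = (z : ℂ) ^ deg i • e i) (z : Circle)
    (ω : V ⊗[ℂ] V) (i j : Fin n) : coeffMatrix e (TensorProduct.map (π z) (π z) ω) i j =
      (z : ℂ) ^ (deg i + deg j) * coeffMatrix e ω i j := by
  have hz : (z : ℂ) ≠ 0 := Circle.coe_ne_zero z
  have hrepr (v : V) (i : Fin n) : e.repr (π z v) i = (z : ℂ) ^ deg i * e.repr v i := by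
    have h : (e.coord i).comp (π z) = (z : ℂ) ^ deg i • e.coord i := by
      refine e.ext fun j => ?_
      rw [LinearMap.comp_apply, hπ, map_smul, LinearMap.smul_apply, e.coord_apply, e.repr_self]
      rcases eq_or_ne j i with rfl | hij
      · rfl
      · simp [hij]
    exact DFunLike.congr_fun h v
  induction ω using TensorProduct.induction_on with
  | zero => simp [coeffMatrix]
  | tmul v w =>
    simp only [coeffMatrix, TensorProduct.map_tmul, Module.Basis.tensorProduct_repr_tmul_apply, hrepr,
      zpow_add₀ hz, smul_eq_mul]
    ring
  | add v w hv hw =>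
    simp only [coeffMatrix, map_add, Finsupp.add_apply, mul_add] at hv hw ⊢
    rw [hv, hw]

/-- Comparing coefficients of `e_i ⊗ e_j` gives `z ^ (d_i + d_j) ω_ij = z ^ d ω_ij` for all `z`, and
distinct integers define distinct characters of the circle. -/
theorem deg_add_deg_of_coeffMatrix_ne_zero (hπ : ∀ z i, π z (e i) = (z : ℂ) ^ deg i • e i) (d : ℤ)
    (ω : V ⊗[ℂ] V) (hω : ∀ z, TensorProduct.map (π z) (π z) ω = (z : ℂ) ^ d • ω) (i j : Fin n)
    (h : coeffMatrix e ω i j ≠ 0) : deg i + deg j = d := by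
  refine Circle.eq_of_forall_zpow_eq fun z => mul_right_cancel₀ h ?_
  rw [← coeffMatrix_map e π deg hπ, hω]
  simp [coeffMatrix]

/-- A representation takes invertible values and `c ≠ 0`, so `Ω̄ Ω` is invertible, and `det Ω`
divides its determinant. -/
theorem isUnit_det_coeffMatrix (ζ : Circle) (d : ℤ) (ω : V ⊗[ℂ] V)
    (hΩ : ∃ c : ℂ, c ≠ 0 ∧ (coeffMatrix e ω).map (starRingEnd ℂ) * coeffMatrix e ω =
      c • LinearMap.toMatrix e e (π (ζ ^ d))) : IsUnit (coeffMatrix e ω).det := by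
  obtain ⟨c, hc, h⟩ := hΩ
  have h1 : IsUnit (LinearMap.toMatrix e e (π (ζ ^ d))) := by
    have := ((Group.isUnit (ζ ^ d)).map π).map (LinearMap.toMatrixAlgEquiv e)
    exact this
  have h2 : IsUnit (c • LinearMap.toMatrix e e (π (ζ ^ d))) := by
    have := h1.smul (Units.mk0 c hc)
    exact this
  rw [← h, Matrix.isUnit_iff_isUnit_det, Matrix.det_mul] at h2
  exact isUnit_of_mul_isUnit_right h2

end Coefficients

/-! ### The theorem -/

theorem mainTheorem4 {n : ℕ} {V : Type*} [AddCommGroup V] [Module ℂ V]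
    (e : Module.Basis (Fin n) ℂ V) (π : Circle →* (V →ₗ[ℂ] V)) (deg : Fin n → ℤ)
    (hπ : ∀ z i, π z (e i) = (z : ℂ) ^ deg i • e i)
    (ζ : Circle) (d : ℤ) (ω : V ⊗[ℂ] V)
    (hω : ∀ z, TensorProduct.map (π z) (π z) ω = (z : ℂ) ^ d • ω)
    (hΩ : ∃ c : ℂ, c ≠ 0 ∧ (coeffMatrix e ω).map (starRingEnd ℂ) * coeffMatrix e ω =
      c • LinearMap.toMatrix e e (π (ζ ^ d))) :
    ∃ β : CircleAction (Ao ζ d deg (coeffMatrix e ω)),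
      (∀ z i j, β.hom (Ao.u ζ d deg (coeffMatrix e ω) i j) z =
        (z : ℂ) ^ (deg j - deg i) • Ao.u ζ d deg (coeffMatrix e ω) i j) ∧
      (∀ β' : Ao ζ d deg (coeffMatrix e ω) →⋆ₐ[ℂ] C(Circle, Ao ζ d deg (coeffMatrix e ω)),
        (∀ z i j, β' (Ao.u ζ d deg (coeffMatrix e ω) i j) z =
          (z : ℂ) ^ (deg j - deg i) • Ao.u ζ d deg (coeffMatrix e ω) i j) → β' = β.hom) ∧
      ∃ Δ : Ao ζ d deg (coeffMatrix e ω) →⋆ₐ[ℂ] BraidedTensor ζ β β,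
        (∀ i k, Δ (Ao.u ζ d deg (coeffMatrix e ω) i k) =
          ∑ l, BraidedTensor.j₁ ζ β β (Ao.u ζ d deg (coeffMatrix e ω) i l) *
            BraidedTensor.j₂ ζ β β (Ao.u ζ d deg (coeffMatrix e ω) l k)) ∧
        (∀ Δ' : Ao ζ d deg (coeffMatrix e ω) →⋆ₐ[ℂ] BraidedTensor ζ β β,
          (∀ i k, Δ' (Ao.u ζ d deg (coeffMatrix e ω) i k) =
            ∑ l, BraidedTensor.j₁ ζ β β (Ao.u ζ d deg (coeffMatrix e ω) i l) *
              BraidedTensor.j₂ ζ β β (Ao.u ζ d deg (coeffMatrix e ω) l k)) → Δ' = Δ) ∧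
        IsBraidedCompactQuantumGroup ζ β Δ := by
  have hdeg := deg_add_deg_of_coeffMatrix_ne_zero e π deg hπ d ω hω
  refine ⟨Ao.action ζ hdeg, Ao.action_hom_u ζ hdeg, fun β' hβ' => Ao.hom_ext fun i j =>
      ContinuousMap.ext fun z => (hβ' z i j).trans (Ao.action_hom_u ζ hdeg z i j).symm,
    Ao.comul ζ hdeg, Ao.comul_u ζ hdeg, fun Δ' hΔ' => Ao.hom_ext fun i k =>
      (hΔ' i k).trans (Ao.comul_u ζ hdeg i k).symm,
    Ao.isBraidedCompactQuantumGroup ζ hdeg (isUnit_det_coeffMatrix e π ζ d ω hΩ)⟩
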